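/- **Setting.** A server holds $m$ files of $F$ bits and is connected by a noiseless shared link to $n\ge 1$ users. Each user has a cache of $M$ files ($\lfloor MF\rfloor$ bits), $0<M\le m$ real, and makes $L\ge 1$ requests; all $nL$ requests are i.i.d. and uniform on the $m$ files (Zipf parameter $\alpha=0$). A caching scheme for file size $F$ consists of caching functions of the library, a multicast encoder mapping library and requests to a finite binary string, and decoders using the string, the own cache and the requests. Its rate $R^{(F)}$ is the maximum over libraries of the expected string length divided by $F$; its error probability is the maximum over libraries of the probability that some user fails to recover its requested files. A number $R$ is achievable if there is a sequence of schemes, $F=1,2,\dots$, with error probability tending to $0$ and $\limsup_F R^{(F)}\le R$; $R^*(n,m,M,L)$ is the infimum of the achievable $R$. **UP-GCLC.** Split each file into $B$ packets. Independently, each user caches, for each file, a uniformly random set of $\lfloor MB/m\rfloor$ of its packets (uniform placement). The conflict digraph has a vertex $v$ for each pair of a user $\mu(v)$ and a packet $\rho(v)$ that it needs (a packet of a file it requests that is not in its cache), with an edge $v\to w$ if $\rho(w)$ is not cached by $\mu(v)$ and $\rho(w)\ne\rho(v)$. The number of local colors of a vertex coloring is the largest number of colors in a closed out-neighborhood ($0$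 if there are no vertices). GCLC takes, of the following two colorings, the one with fewer local colors, and transmits that number of packets. (1) Greedy constrained coloring: repeatedly pick an uncolored vertex $v$, scan the other uncolored vertices, add to the class of $v$ each one that has no edge to or from the class and has the same label as $v$, where the label of $v$ is the set of users that cache $\rho(v)$, together with $\mu(v)$; give the class a new color; choices are resolved by an arbitrary rule. (2) Vertices have the same color exactly if they are the same packet. The codeword is $\sum_c \mathbf a_c s_c$ over $\mathbb F_{2^{F/B}}$, where $s_c$ is the sum of the distinct packets of color $c$ and the $\mathbf a_c$ are the columns of an MDS generator matrix with as many rows as there are local colors. Let $R_B$ be the number of transmitted packets divided by $B$, averaged over the requests (it is random through the placement), and let $R^{\rm UP\text{-}GCLC}(n,m,M,L)$ be its limit superior in probability as $B\to\infty$, i.e. $\inf\{r:\lim_{B\to\infty}\mathbb P(R_B\le r)=1\}$. **Theorem.** For every rule resolving the greedy choices: 1. For all $n,m,M,L$ as above, every $B\ge1$ and every outcome of the uniform placement, if $F/B$ is a sufficiently large integer then, for a suitable choice of the MDS generator matrices, UP-GCLC is a caching scheme for file size $F$ with error probability $0$ and rate $R_B$. Moreover $R^{\rm UP\text{-}GCLC}(n,m,M,L)$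 is achievable. 2. For all $n,m,M,L$ as above and all $\varepsilon>0$, $$\lim_{B\to\infty}\mathbb P\Big(R_B\le \min\Big\{L\Big(\frac mM-1\Big),\,Ln,\,m-M\Big\}+\varepsilon\Big)=1,$$ so that $$R^{\rm UP\text{-}GCLC}(n,m,M,L)\le\min\Big\{L\Big(\frac mM-1\Big),\,Ln,\,m-M\Big\}.$$ 3. UP-GCLC, and already this upper bound, is order-optimal: there is a constant $1\le\nu<\infty$, independent of $n,m,M,L$ and of the rule, such that for all $n=n(m)\to\infty$, $L=L(m)\ge1$ and $0<M=M(m)\le m$, $$\limsup_{m\to\infty}\frac{R^{\rm UP\text{-}GCLC}(n,m,M,L)}{R^*(n,m,M,L)}\le\nu,\qquad \limsup_{m\to\infty}\frac{\min\{L(\frac mM-1),\,Ln,\,m-M\}}{R^*(n,m,M,L)}\le\nu,$$ meaning that for every $\varepsilon>0$ the numerator is at most $(\nu+\varepsilon)R^*(n,m,M,L)$ for all large $m$ (so both numerators must vanish where $R^*=0$). -/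

import Mathlib

open Filter Topology

noncomputable section

namespace CodedCaching

/-! ### Network model -/

/-- A library of `m` files of `F` bits each. -/
abbrev Library (m F : ℕ) : Type := Fin m → Fin F → ZMod 2

/-- A request matrix: `d u l` is the `l`-th file requested by user `u`. -/
abbrev Demand (n m L : ℕ) : Type := Fin n → Fin L → Fin m

/-- Zipf distribution with parameter `α` on `m` files; the file with index `f` has rank `f + 1`. -/
def zipf (α : ℝ) (m : ℕ) (f : Fin m) : ℝ :=
  ((f : ℝ) + 1) ^ (-α) / ∑ i : Fin m, ((i : ℝ) + 1) ^ (-α)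

/-- Expectation over the request matrix, whose `n * L` entries are i.i.d. with law `q`. -/
def demandExp {n m L : ℕ} (q : Fin m → ℝ) (g : Demand n m L → ℝ) : ℝ :=
  ∑ d : Demand n m L, (∏ u, ∏ l, q (d u l)) * g d

/-- A caching scheme for file size `F`: caching functions with `M F` bits per user (rounded down),
a fixed-to-variable multicast encoder, and decoding functions. -/
structure CachingScheme (n m L : ℕ) (M : ℝ) (F : ℕ) where
  cache : Fin n → Library m F → (Fin ⌊M * F⌋₊ → ZMod 2)
  encode : Library m F → Demand n m L → List (ZMod 2)
  decode : Fin n → List (ZMod 2) → (Fin ⌊M * F⌋₊ → ZMod 2) → Demand n m L →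
    (Fin L → Fin F → ZMod 2)

/-- The (average) rate: worst case over the library of the expected codeword length, in files. -/
def CachingScheme.rate {n m L : ℕ} {M : ℝ} {F : ℕ} (S : CachingScheme n m L M F)
    (q : Fin m → ℝ) : ℝ :=
  ⨆ W : Library m F, demandExp q (fun d => ((S.encode W d).length : ℝ)) / F

open scoped Classical in
/-- Worst case over the library of the probability that some user decodes incorrectly. -/
def CachingScheme.errorProb {n m L : ℕ} {M : ℝ} {F : ℕ} (S : CachingScheme n m L M F)
    (q : Fin m → ℝ) : ℝ :=
  ⨆ W : Library m F, demandExp q (fun d =>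
    if ∃ u, S.decode u (S.encode W d) (S.cache u W) d ≠ fun l => W (d u l) then 1 else 0)

/-- `R` is achievable: some admissible sequence of schemes has `limsup` of the rates at most `R`. -/
def Achievable (n m L : ℕ) (M : ℝ) (q : Fin m → ℝ) (R : ℝ) : Prop :=
  ∃ S : ∀ F : ℕ, CachingScheme n m L M F,
    Tendsto (fun F => (S F).errorProb q) atTop (𝓝 0) ∧
    ∀ ε : ℝ, 0 < ε → ∀ᶠ F in atTop, (S F).rate q ≤ R + ε

/-- The optimal rate: the infimum of the achievable rates. -/
def optimalRate (n m L : ℕ) (M : ℝ) (q : Fin m → ℝ) : ℝ :=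
  sInf {R : ℝ | Achievable n m L M q R}

/-- `limsup (R m / R' m) ≤ ν` for nonnegative sequences, written without division
(so that where `R' m = 0` it asks for `R m ≤ 0`). -/
def LimsupRatioLE (R R' : ℕ → ℝ) (ν : ℝ) : Prop :=
  ∀ ε : ℝ, 0 < ε → ∀ᶠ m in atTop, R m ≤ (ν + ε) * R' m

/-! ### Random popularity-based caching -/

/-- Packet-level cache configuration for `B` packets per file: `C u f` is the set of packets of
file `f` cached at user `u`. -/
abbrev Placement (n m B : ℕ) : Type := Fin n → Fin m → Finset (Fin B)

/-- The possible outcomes of the random placement with caching distribution `p`: every user caches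
`p f * M * B` packets (rounded down) of every file `f`. -/
def rapPlacements (n m B : ℕ) (M : ℝ) (p : Fin m → ℝ) : Finset (Placement n m B) :=
  {C | ∀ u f, (C u f).card = ⌊p f * M * B⌋₊}

open scoped Classical in
/-- Probability of an event under the random placement. The sets `C u f` are independent and each
is uniform among the sets of its size, i.e. `C` is uniform on `rapPlacements`. -/
def rapProb (n m B : ℕ) (M : ℝ) (p : Fin m → ℝ) (E : Placement n m B → Prop) : ℝ :=
  (((rapPlacements n m B M p).filter E).card : ℝ) / ((rapPlacements n m B M p).card : ℝ)

/-- The uniform caching distribution. -/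
def uniformPlacement (m : ℕ) (_ : Fin m) : ℝ := 1 / m

/-! ### The conflict graph and greedy constrained local coloring (GCLC) -/

/-- A packet: a file together with the index of one of its `B` packets. -/
abbrev Packet (m B : ℕ) : Type := Fin m × Fin B

/-- A vertex of the conflict graph: a user together with a packet it requests. -/
abbrev Vertex (n m B : ℕ) : Type := Fin n × Packet m B

/-- User `u` has packet `p` in its cache. -/
def Cached {n m B : ℕ} (C : Placement n m B) (u : Fin n) (p : Packet m B) : Prop :=
  p.2 ∈ C u p.1

open scoped Classical in
/-- The vertices of the conflict graph: one for each user and each packet that the user needs, that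
is, each packet of a file it requests that is not in its own cache. -/
def vertices {n m L B : ℕ} (C : Placement n m B) (d : Demand n m L) : Finset (Vertex n m B) :=
  {v | (∃ l, d v.1 l = v.2.1) ∧ ¬ Cached C v.1 v.2}

/-- Directed conflict graph: an edge from `v` to `w` if `w` interferes with `v`, i.e. the packet of
`w` is not cached by the user of `v` and differs from the packet of `v`. -/
def conflictGraph {n m B : ℕ} (C : Placement n m B) : Digraph (Vertex n m B) where
  Adj v w := ¬ Cached C v.1 w.2 ∧ w.2 ≠ v.2

open scoped Classical in
/-- The set of the users that either request the vertex's packet at this vertex or cache it. -/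
def label {n m B : ℕ} (C : Placement n m B) (v : Vertex n m B) : Finset (Fin n) :=
  {u | u = v.1 ∨ Cached C u v.2}

/-- The possible outcomes (sets of color classes) of the greedy constrained coloring of the vertex
set `U`: while uncolored vertices remain, pick any one, `v`; go through the other uncolored
vertices in any order, adding to the class `I` of `v` each one that has the label of `v` and no
edge to or from `I`; give `I` a new color. (The sets `I` that such a pass can produce are exactly
the inclusion-maximal independent sets of vertices with the label of `v` that contain `v`.) -/
inductive IsGreedyColoring {n m B : ℕ} (C : Placement n m B) :
    Finset (Vertex n m B) → Finset (Finset (Vertex n m B)) → Prop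
  | nil : IsGreedyColoring C ∅ ∅
  | step (U I : Finset (Vertex n m B)) (P : Finset (Finset (Vertex n m B))) (v : Vertex n m B)
      (hIU : I ⊆ U) (hv : v ∈ I)
      (hlabel : ∀ w ∈ I, label C w = label C v)
      (hindep : ∀ w ∈ I, ∀ w' ∈ I, ¬ (conflictGraph C).Adj w w')
      (hmax : ∀ w ∈ U, w ∉ I → label C w = label C v →
        ∃ w' ∈ I, (conflictGraph C).Adj w w' ∨ (conflictGraph C).Adj w' w)
      (hrest : IsGreedyColoring C (U \ I) P) :
      IsGreedyColoring C U (insert I P)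

/-- A rule resolving the arbitrary choices of the greedy constrained coloring. -/
structure GreedyRule where
  classes : ∀ {n m L B : ℕ}, Placement n m B → Demand n m L → Finset (Finset (Vertex n m B))
  isGreedy : ∀ {n m L B : ℕ} (C : Placement n m B) (d : Demand n m L),
    IsGreedyColoring C (vertices C d) (classes C d)

theorem exists_isGreedyColoring {n m B : ℕ} (C : Placement n m B) (U : Finset (Vertex n m B)) :
    ∃ P, IsGreedyColoring C U P := by
  classical
  induction U using Finset.strongInduction with
  | H U ih =>
    rcases U.eq_empty_or_nonempty with rfl | ⟨v, hv⟩
    · exact ⟨∅, .nil⟩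
    · let Q : Finset (Vertex n m B) → Prop := fun I => v ∈ I ∧ (∀ w ∈ I, label C w = label C v) ∧
        ∀ w ∈ I, ∀ w' ∈ I, ¬ (conflictGraph C).Adj w w'
      have hne : (U.powerset.filter Q).Nonempty := by
        refine ⟨{v}, Finset.mem_filter.2 ⟨by simpa using hv, Finset.mem_singleton_self v, ?_, ?_⟩⟩
        · intro w hw
          rw [Finset.mem_singleton.1 hw]
        · intro w hw w' hw'
          rw [Finset.mem_singleton.1 hw, Finset.mem_singleton.1 hw']
          exact fun h => h.2 rfl
      obtain ⟨I, hI⟩ := (U.powerset.filter Q).exists_maximal hne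
      have hIm := hI.1
      simp only [Finset.mem_filter, Finset.mem_powerset, Q] at hIm
      obtain ⟨hIU, hvI, hl, hind⟩ := hIm
      obtain ⟨P, hP⟩ := ih (U \ I) (Finset.sdiff_ssubset hIU ⟨v, hvI⟩)
      refine ⟨insert I P, .step U I P v hIU hvI hl hind ?_ hP⟩
      intro w hwU hwI hwl
      by_contra hcon
      push Not at hcon
      have hmem : insert w I ∈ U.powerset.filter Q := by
        simp only [Finset.mem_filter, Finset.mem_powerset, Q]
        refine ⟨Finset.insert_subset hwU hIU, Finset.mem_insert_of_mem hvI, ?_, ?_⟩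
        · intro x hx
          rcases Finset.mem_insert.1 hx with rfl | hx
          · exact hwl
          · exact hl x hx
        · intro x hx y hy
          rcases Finset.mem_insert.1 hx with hxw | hx <;>
            rcases Finset.mem_insert.1 hy with hyw | hy
          · rw [hxw, hyw]
            exact fun h => h.2 rfl
          · rw [hxw]
            exact (hcon y hy).1
          · rw [hyw]
            exact (hcon x hx).2
          · exact hind x hx y hy
      exact hwI (hI.2 hmem (Finset.subset_insert w I) (Finset.mem_insert_self w I))

instance : Nonempty GreedyRule :=
  ⟨⟨fun C d => Classical.choose (exists_isGreedyColoring C (vertices C d)),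
    fun C d => Classical.choose_spec (exists_isGreedyColoring C (vertices C d))⟩⟩

/-- The second coloring compared by GCLC: two vertices have the same color if and only if they are
the same packet (requested by possibly different users). -/
def packetColoring {n m L B : ℕ} (C : Placement n m B) (d : Demand n m L) :
    Finset (Finset (Vertex n m B)) :=
  (vertices C d).image fun v => (vertices C d).filter fun w => w.2 = v.2

open scoped Classical in
/-- The largest number of colors in a closed out-neighborhood, for the coloring of the conflict
graph with color classes `P`. -/
def localColors {n m L B : ℕ} (C : Placement n m B) (d : Demand n m L)
    (P : Finset (Finset (Vertex n m B))) : ℕ :=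
  (vertices C d).sup fun v =>
    (P.filter fun I => ∃ w ∈ I, w = v ∨ (conflictGraph C).Adj v w).card

/-- The color classes chosen by GCLC: of the greedy constrained coloring and the packet coloring,
the one with the smaller number of local colors. -/
def GreedyRule.gclc (g : GreedyRule) {n m L B : ℕ} (C : Placement n m B) (d : Demand n m L) :
    Finset (Finset (Vertex n m B)) :=
  if localColors C d (g.classes C d) ≤ localColors C d (packetColoring C d) then g.classes C d
  else packetColoring C d

/-- The number of packet transmissions of GCLC. -/
def GreedyRule.transmissions (g : GreedyRule) {n m L B : ℕ} (C : Placement n m B)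
    (d : Demand n m L) : ℕ :=
  localColors C d (g.gclc C d)

/-- The rate of GCLC (in files) for the cache configuration `C`, averaged over the requests. -/
def GreedyRule.gclcRate (g : GreedyRule) {n m B : ℕ} (L : ℕ) (q : Fin m → ℝ)
    (C : Placement n m B) : ℝ :=
  demandExp q (fun d : Demand n m L => (g.transmissions C d : ℝ)) / B

/-- The rate of RAP-GCLC as `B → ∞`: the limit superior in probability, over the random placement,
of the rate of GCLC. -/
def GreedyRule.rapGclcRate (g : GreedyRule) (n m L : ℕ) (M : ℝ) (q p : Fin m → ℝ) : ℝ :=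
  sInf {r : ℝ | Tendsto (fun B : ℕ =>
    rapProb n m B M p (fun C => g.gclcRate L q C ≤ r)) atTop (𝓝 1)}

/-! ### RAP-GCLC as a caching scheme -/

/-- The `j`-th of the `B` packets of file `f`, a block of `k` consecutive bits, as a symbol of the
field with `2 ^ k` elements (through a fixed linear identification `e` of symbols and blocks). -/
def packetSymbol {m B k : ℕ} (e : GaloisField 2 k ≃ₗ[ZMod 2] (Fin k → ZMod 2))
    (W : Library m (B * k)) (p : Packet m B) : GaloisField 2 k :=
  e.symm fun i => W p.1 (finProdFinEquiv (p.2, i))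

/-- The bits of a vector of symbols. -/
def symbolBits {k r : ℕ} (e : GaloisField 2 k ≃ₗ[ZMod 2] (Fin k → ZMod 2))
    (y : Fin r → GaloisField 2 k) : List (ZMod 2) :=
  List.ofFn fun i : Fin (r * k) => e (y (finProdFinEquiv.symm i).1) (finProdFinEquiv.symm i).2

/-- `A` generates an MDS code: any `r` of its columns are linearly independent. -/
def IsMDSGenerator {r : ℕ} {ι K : Type*} [Field K] (A : Matrix (Fin r) ι K) : Prop :=
  ∀ s : Finset ι, s.card = r → LinearIndependent K (fun j : s => fun i : Fin r => A i j)

/-- `S` is RAP-GCLC for the cache configuration `C`. Each cache holds (precisely) the packets that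
`C` assigns to it. The codeword is the combination, with the columns of an MDS generator matrix as
coding vectors (one column per color), of the sums of the packets of each color. -/
def CachingScheme.IsGCLC {n m L : ℕ} {M : ℝ} {B k : ℕ} (S : CachingScheme n m L M (B * k))
    (g : GreedyRule) (e : GaloisField 2 k ≃ₗ[ZMod 2] (Fin k → ZMod 2)) (C : Placement n m B) :
    Prop :=
  (∀ u W W', S.cache u W = S.cache u W' ↔
    ∀ p : Packet m B, Cached C u p → packetSymbol e W p = packetSymbol e W' p) ∧
  ∀ d : Demand n m L,
    ∃ A : Matrix (Fin (g.transmissions C d)) (g.gclc C d) (GaloisField 2 k),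
      IsMDSGenerator A ∧
      ∀ W, S.encode W d = symbolBits e (A.mulVec fun I =>
        ∑ p ∈ (I : Finset (Vertex n m B)).image Prod.snd, packetSymbol e W p)

end CodedCaching

end

noncomputable section

namespace CodedCaching

/-! Write `p = M / m`. For the upper bound, a packet is cached by exactly the users in `S` with
probability about `p ^ |S| * (1 - p) ^ (n - |S|)`, and Chebyshev's inequality makes all these
frequencies concentrate as `B → ∞`. Vertices with a common label that belong to different users
never conflict. A greedy class therefore meets every user that still has uncolored vertices of its
label, and a label `T` costs only the largest number of its vertices at one user
(`IsGreedyColoring.card_le`). For nonempty `T` this is at most about `L * p ^ (|T| - 1) * (1 - p) ^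
(n - |T| + 1) * B`; by the binomial theorem the sum over `T` is at most about `L * (1 - p) / p * B`,
which is `L * (m / M - 1) * B`. The bound `L * n` counts vertices. The bound `m - M` holds because
under the packet coloring a user sees only colors of packets that it does not cache.

For the converse, an error probability below that of a single request must vanish, so only
zero-error schemes matter. If `t` requests of the first `s` users involve every file, the `t`
codewords and `s` caches determine the library, so the codewords carry about `(m - s * M) * F` bits.
A request for `σ` files can be relabeled into about `m / σ` requests that cover the library, and
averaging over all permutations of the files shares the cost equally
(`CachingScheme.ZeroError.le_sum_sum_length`). Since `s` users request at least `min (s * L) m / 2`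
files on average, a suitable `s` matches the upper bound within a factor 32 (`Achievable.min_le`).

For achievability, a user must solve for its packet from the coded sums. Colors outside its closed
out-neighborhood contain no unknown interference, but they may contain the wanted packet itself,
requested by another user and colored differently. The column of the wanted color is then replaced
by a sum of columns, so the MDS property alone is not what the decoding argument uses. A generic
matrix over a large field of characteristic 2 keeps the relevant sums independent
(`exists_isGenericMatrix`, `eq_zero_of_mulVec_color_sums`). Finally, a placement of nearly the
limiting rate exists; it is fixed, and its scheme is extended to all large `F` at vanishing cost
(`GreedyRule.achievable_rapGclcRate`). -/

/-! ### Expectation over uniform requests -/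

theorem zipf_zero {m : ℕ} (f : Fin m) : zipf 0 m f = 1 / m := by
  simp [zipf]

theorem demandExp_zipf_zero {n m L : ℕ} (g : Demand n m L → ℝ) :
    demandExp (zipf 0 m) g = (∑ d, g d) / (m : ℝ) ^ (n * L) := by
  simp only [demandExp, zipf_zero, Finset.prod_const, Finset.card_univ, Fintype.card_fin]
  rw [← Finset.mul_sum, ← pow_mul, mul_comm L n, one_div, inv_pow, div_eq_inv_mul]

theorem demandExp_zipf_zero_mono {n m L : ℕ} {g h : Demand n m L → ℝ} (H : ∀ d, g d ≤ h d) :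
    demandExp (zipf 0 m) g ≤ demandExp (zipf 0 m) h := by
  rw [demandExp_zipf_zero, demandExp_zipf_zero]
  exact div_le_div_of_nonneg_right (Finset.sum_le_sum fun d _ => H d) (by positivity)

theorem demandExp_zipf_zero_const {n m L : ℕ} (hm : 1 ≤ m) (c : ℝ) :
    demandExp (zipf 0 m) (fun _ : Demand n m L => c) = c := by
  have : (m : ℝ) ≠ 0 := by positivity
  rw [demandExp_zipf_zero]
  simp only [Finset.sum_const, Finset.card_univ, Fintype.card_pi, Fintype.card_fin,
    Finset.prod_const, nsmul_eq_mul, Nat.cast_pow]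
  rw [← pow_mul, mul_comm L n]
  field_simp

theorem demandExp_zipf_zero_nonneg {n m L : ℕ} {g : Demand n m L → ℝ} (H : ∀ d, 0 ≤ g d) :
    0 ≤ demandExp (zipf 0 m) g := by
  rw [demandExp_zipf_zero]
  exact div_nonneg (Finset.sum_nonneg fun d _ => H d) (by positivity)

theorem demandExp_zipf_zero_le {n m L : ℕ} (hm : 1 ≤ m) {g : Demand n m L → ℝ} {c : ℝ}
    (H : ∀ d, g d ≤ c) : demandExp (zipf 0 m) g ≤ c :=
  (demandExp_zipf_zero_mono H).trans (demandExp_zipf_zero_const hm c).le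

theorem demandExp_add {n m L : ℕ} (q : Fin m → ℝ) (g h : Demand n m L → ℝ) :
    demandExp q (fun d => g d + h d) = demandExp q g + demandExp q h := by
  simp only [demandExp, mul_add, Finset.sum_add_distrib]

theorem demandExp_mul_const {n m L : ℕ} (q : Fin m → ℝ) (g : Demand n m L → ℝ) (c : ℝ) :
    demandExp q (fun d => g d * c) = demandExp q g * c := by
  simp only [demandExp, Finset.sum_mul, mul_assoc]

/-! ### Converse: counting codewords and covering the library -/

/-- A Kraft-type inequality for arbitrary (not necessarily prefix-free) binary strings. -/
theorem sum_pow_length_le {r : ℝ} (h0 : 0 ≤ r) (h1 : 2 * r < 1) (X : Finset (List (ZMod 2))) :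
    ∑ x ∈ X, r ^ x.length ≤ (1 - 2 * r)⁻¹ := by
  classical
  rw [← Finset.sum_fiberwise_of_maps_to (t := X.image List.length)
    (fun x hx => Finset.mem_image_of_mem _ hx)]
  -- There are at most `2 ^ i` strings of length `i`, so the sum is dominated by a geometric series.
  have key : ∀ i ∈ X.image List.length,
      ∑ x ∈ X with x.length = i, r ^ x.length ≤ (2 * r) ^ i := by
    intro i _
    rw [Finset.sum_congr rfl (g := fun _ => r ^ i)
      (fun x hx => by rw [(Finset.mem_filter.1 hx).2]), Finset.sum_const, nsmul_eq_mul, mul_pow]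
    refine mul_le_mul_of_nonneg_right ?_ (by positivity)
    have hsub : (X.filter fun x => x.length = i) ⊆
        (Finset.univ : Finset (Fin i → ZMod 2)).image List.ofFn := by
      intro x hx
      obtain ⟨-, rfl⟩ := Finset.mem_filter.1 hx
      exact Finset.mem_image.2 ⟨x.get, Finset.mem_univ _, List.ofFn_get x⟩
    have := (Finset.card_le_card hsub).trans Finset.card_image_le
    simp only [Finset.card_univ, Fintype.card_pi, ZMod.card, Finset.prod_const,
      Fintype.card_fin] at this
    exact_mod_cast this
  refine (Finset.sum_le_sum key).trans ?_
  rw [← tsum_geometric_of_lt_one (by positivity) h1]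
  exact (summable_geometric_of_lt_one (by positivity) h1).sum_le_tsum _
    (fun i _ => by positivity)

/-- If `t` strings and a symbol of `β` determine a uniformly distributed element of `Ω`, then the
expected total length of the strings is at least about `log₂ (|Ω| / |β|)`. -/
theorem le_sum_length_of_injective {Ω β ι : Type*} [Fintype Ω] [Fintype β] [Fintype ι]
    (x : Ω → ι → List (ZMod 2)) (ζ : Ω → β) (hinj : Function.Injective fun w => (x w, ζ w))
    {a c : ℝ} (ha : Real.log 2 < a)
    (hc : (Fintype.card β : ℝ) * ((1 - 2 * Real.exp (-a))⁻¹) ^ Fintype.card ι ≤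
      Fintype.card Ω * Real.exp (-(a * c))) :
    (Fintype.card Ω : ℝ) * c ≤ ∑ w, ∑ i, ((x w i).length : ℝ) := by
  classical
  have ha0 : 0 < a := (Real.log_pos one_lt_two).trans ha
  set r := Real.exp (-a) with hr
  have hr0 : 0 < r := Real.exp_pos _
  have hr1 : 2 * r < 1 := by
    rw [hr, Real.exp_neg, ← div_eq_mul_inv, div_lt_one (Real.exp_pos _)]
    exact (Real.log_lt_iff_lt_exp two_pos).1 ha
  let X : Finset (List (ZMod 2)) := Finset.univ.image fun p : Ω × ι => x p.1 p.2
  -- The weight `exp (-a * total length)`. Injectivity bounds its sum over `Ω` by the sum over all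
  -- possible outputs, which factors into Kraft sums.
  let f : (ι → List (ZMod 2)) × β → ℝ := fun y => ∏ i, r ^ (y.1 i).length
  have h1 : ∑ w, f (x w, ζ w) ≤ Fintype.card β * ((1 - 2 * r)⁻¹) ^ Fintype.card ι := by
    rw [← Finset.sum_image (s := Finset.univ) (g := fun w => (x w, ζ w)) (f := f)
      (fun a _ b _ h => hinj h)]
    calc _ ≤ ∑ y ∈ (Fintype.piFinset fun _ : ι => X) ×ˢ (Finset.univ : Finset β), f y := by
          refine Finset.sum_le_sum_of_subset_of_nonneg ?_
            (fun y _ _ => Finset.prod_nonneg fun i _ => by positivity)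
          intro y hy
          obtain ⟨w, -, rfl⟩ := Finset.mem_image.1 hy
          refine Finset.mem_product.2 ⟨Fintype.mem_piFinset.2 fun i => ?_, Finset.mem_univ _⟩
          exact Finset.mem_image.2 ⟨(w, i), Finset.mem_univ _, rfl⟩
      _ = Fintype.card β * (∑ y ∈ X, r ^ y.length) ^ Fintype.card ι := by
          rw [Finset.sum_product]
          simp only [f, Finset.sum_const, Finset.card_univ, nsmul_eq_mul]
          rw [← Finset.mul_sum, ← Finset.prod_univ_sum (fun _ : ι => X)
            (fun _ y => r ^ y.length), Finset.prod_const, Finset.card_univ]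
      _ ≤ _ := by
          gcongr
          exact sum_pow_length_le hr0.le hr1 X
  -- The tangent of `exp (-a * x)` at `x = c` takes the place of Jensen's inequality.
  have h2 : ∀ w, Real.exp (-(a * c)) * (1 - a * (∑ i, ((x w i).length : ℝ) - c)) ≤
      f (x w, ζ w) := by
    intro w
    have : f (x w, ζ w) = Real.exp (-(a * c)) *
        Real.exp (-(a * (∑ i, ((x w i).length : ℝ) - c))) := by
      simp only [f]
      rw [Finset.prod_pow_eq_pow_sum, hr, ← Real.exp_nat_mul, ← Real.exp_add]
      congr 1
      push_cast
      ring
    rw [this]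
    refine mul_le_mul_of_nonneg_left ?_ (Real.exp_pos _).le
    have := Real.add_one_le_exp (-(a * (∑ i, ((x w i).length : ℝ) - c)))
    linarith
  have h3 := ((Finset.sum_le_sum fun w (_ : w ∈ Finset.univ) => h2 w).trans h1).trans hc
  rw [← Finset.mul_sum, mul_comm (Fintype.card Ω : ℝ)] at h3
  have h4 := le_of_mul_le_mul_left h3 (Real.exp_pos _)
  simp only [Finset.sum_sub_distrib, ← Finset.mul_sum, Finset.sum_const, Finset.card_univ,
    nsmul_eq_mul, mul_one] at h4
  have h5 : 0 ≤ a * (∑ w, ∑ i, ((x w i).length : ℝ) - Fintype.card Ω * c) := by linarith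
  have := nonneg_of_mul_nonneg_right h5 ha0
  linarith

/-- A nonempty set of files and about `m / |S|` permutations whose images of it cover all files. -/
theorem exists_perms_cover {m : ℕ} (S : Finset (Fin m)) (hS : S.Nonempty) :
    ∃ t : ℕ, 1 ≤ t ∧ t * S.card ≤ 2 * m ∧ t ≤ m ∧ ∃ π : Fin t → Equiv.Perm (Fin m),
      ∀ f, ∃ i, ∃ x ∈ S, π i x = f := by
  classical
  have hm : 0 < m := (Fin.pos hS.choose)
  have : NeZero m := ⟨hm.ne'⟩
  set σ := S.card with hσ
  have hσ0 : 0 < σ := hS.card_pos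
  have hσm : σ ≤ m := by simpa using S.card_le_univ
  have hcard : Fintype.card {x // x ∈ S} = Fintype.card {x : Fin m // x.val < σ} := by
    rw [Fintype.card_coe, Fintype.card_subtype]
    have : (Finset.univ.filter fun x : Fin m => x.val < σ) =
        (Finset.univ : Finset (Fin σ)).map (Fin.castLEEmb hσm) := by
      ext x
      simp only [Finset.mem_filter, Finset.mem_univ, true_and, Finset.mem_map]
      exact ⟨fun h => ⟨⟨x, h⟩, rfl⟩, by rintro ⟨y, rfl⟩; exact y.2⟩
    rw [this]
    simp [hσ]
  let e : {x // x ∈ S} ≃ {x : Fin m // x.val < σ} := Fintype.equivOfCardEq hcard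
  -- This is `⌈m / σ⌉`. The `i`-th permutation moves `S` onto the first `σ` indices and then shifts
  -- cyclically by `i * σ`.
  refine ⟨(m - 1) / σ + 1, Nat.le_add_left _ _, ?_, ?_, fun i =>
    (e.extendSubtype).trans (Equiv.addRight (Fin.ofNat m (i * σ))), ?_⟩
  · have := Nat.div_mul_le_self (m - 1) σ
    rw [add_mul, one_mul]
    omega
  · have := Nat.div_le_self (m - 1) σ
    omega
  · intro f
    have hlt : f.val / σ < (m - 1) / σ + 1 :=
      Nat.lt_succ_of_le (Nat.div_le_div_right (by have := f.2; omega))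
    have hr : f.val % σ < σ := Nat.mod_lt _ hσ0
    let y : {x : Fin m // x.val < σ} := ⟨⟨f.val % σ, hr.trans_le hσm⟩, hr⟩
    refine ⟨⟨f.val / σ, hlt⟩, (e.symm y : Fin m), (e.symm y).2, ?_⟩
    rw [Equiv.trans_apply, Equiv.extendSubtype_apply_of_mem _ _ (e.symm y).2]
    apply Fin.ext
    simp only [Subtype.coe_eta, Equiv.apply_symm_apply, Equiv.coe_addRight, Fin.val_add, y,
      Fin.val_ofNat]
    rw [Nat.add_mod_mod, Nat.mod_add_div', Nat.mod_eq_of_lt f.2]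

/-! ### Converse: zero-error schemes and the bound on the rate -/

/-- Every user always recovers its requested files. -/
def CachingScheme.ZeroError {n m L : ℕ} {M : ℝ} {F : ℕ} (S : CachingScheme n m L M F) : Prop :=
  ∀ W d u, S.decode u (S.encode W d) (S.cache u W) d = fun l => W (d u l)

theorem CachingScheme.ZeroError.errorProb_eq_zero {n m L : ℕ} {M : ℝ} {F : ℕ}
    {S : CachingScheme n m L M F} (hS : S.ZeroError) (q : Fin m → ℝ) : S.errorProb q = 0 := by
  have h : ∀ W d, ¬ ∃ u, S.decode u (S.encode W d) (S.cache u W) d ≠ fun l => W (d u l) :=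
    fun W d ⟨u, hu⟩ => hu (hS W d u)
  simp [CachingScheme.errorProb, h, demandExp]

/-- A small enough error probability vanishes, as there are finitely many requests. -/
theorem CachingScheme.zeroError_of_errorProb_lt {n m L : ℕ} {M : ℝ} {F : ℕ}
    {S : CachingScheme n m L M F} (hS : S.errorProb (zipf 0 m) < 1 / (m : ℝ) ^ (n * L)) :
    S.ZeroError := by
  classical
  intro W d u
  by_contra hne
  refine absurd hS (not_lt.2 ?_)
  rw [CachingScheme.errorProb]
  refine le_trans ?_ (le_ciSup (Set.finite_range _).bddAbove W)
  rw [demandExp_zipf_zero]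
  refine div_le_div_of_nonneg_right ?_ (by positivity)
  refine le_trans ?_ (Finset.single_le_sum (fun d _ => ?_) (Finset.mem_univ d))
  · rw [if_pos ⟨u, hne⟩]
  · split_ifs <;> norm_num

open scoped Classical in
/-- The files requested by the first `s` users. -/
def firstFiles {n m L : ℕ} (s : ℕ) (d : Demand n m L) : Finset (Fin m) :=
  {f | ∃ u l, u.val < s ∧ d u l = f}

theorem mem_firstFiles {n m L s : ℕ} {d : Demand n m L} {f : Fin m} :
    f ∈ firstFiles s d ↔ ∃ u l, u.val < s ∧ d u l = f := by
  simp [firstFiles]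

theorem firstFiles_nonempty {n m L s : ℕ} (hn : 1 ≤ n) (hL : 1 ≤ L) (hs : 1 ≤ s)
    (d : Demand n m L) : (firstFiles s d).Nonempty :=
  ⟨d ⟨0, hn⟩ ⟨0, hL⟩, mem_firstFiles.2 ⟨⟨0, hn⟩, ⟨0, hL⟩, hs, rfl⟩⟩

/-- Each file is decoded, from one of the codewords, by one of the first `s` users; hence codewords
and caches together identify the library. -/
theorem CachingScheme.ZeroError.injective {n m L : ℕ} {M : ℝ} {F s : ℕ}
    {S : CachingScheme n m L M F} (hS : S.ZeroError) (hsn : s ≤ n) {ι : Type*}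
    (d : ι → Demand n m L) (hcov : ∀ f, ∃ i, f ∈ firstFiles s (d i)) :
    Function.Injective fun W : Library m F =>
      ((fun i => S.encode W (d i)), fun u : Fin s => S.cache (Fin.castLE hsn u) W) := by
  intro W W' h
  simp only [Prod.mk.injEq] at h
  funext f
  obtain ⟨i, hi⟩ := hcov f
  obtain ⟨u, l, hu, rfl⟩ := mem_firstFiles.1 hi
  have h1 : S.encode W (d i) = S.encode W' (d i) := congrFun h.1 i
  have h2 : S.cache u W = S.cache u W' := congrFun h.2 ⟨u, hu⟩
  have h3 := hS W (d i) u
  rw [h1, h2, hS W' (d i) u] at h3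
  exact (congrFun h3 l).symm

/-- Covering bound: requests that together involve all files of the library (among the first `s`
users) need a total expected codeword length of about `(m - s M) F`. -/
theorem CachingScheme.ZeroError.le_sum_length {n m L : ℕ} {M : ℝ} {F s t : ℕ}
    {S : CachingScheme n m L M F} (hS : S.ZeroError) (hM : 0 ≤ M) (hsn : s ≤ n) {a : ℝ}
    (ha : Real.log 2 < a) (d : Fin t → Demand n m L)
    (hcov : ∀ f, ∃ i, f ∈ firstFiles s (d i)) :
    (2 : ℝ) ^ (m * F) * (((m - s * M) * F * Real.log 2 -
        t * Real.log (1 - 2 * Real.exp (-a))⁻¹) / a) ≤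
      ∑ W : Library m F, ∑ i, ((S.encode W (d i)).length : ℝ) := by
  have ha0 : 0 < a := (Real.log_pos one_lt_two).trans ha
  have hr1 : 2 * Real.exp (-a) < 1 := by
    rw [Real.exp_neg, ← div_eq_mul_inv, div_lt_one (Real.exp_pos _)]
    exact (Real.log_lt_iff_lt_exp two_pos).1 ha
  have hK : 0 < (1 - 2 * Real.exp (-a))⁻¹ := inv_pos.2 (by linarith)
  have hcard : (Fintype.card (Library m F) : ℝ) = 2 ^ (m * F) := by
    simp [Fintype.card_pi, ← pow_mul, mul_comm]
  rw [← hcard]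
  refine le_sum_length_of_injective _ _ (hS.injective hsn d hcov) ha ?_
  rw [hcard, mul_div_cancel₀ _ ha0.ne']
  have hcard' : (Fintype.card (Fin s → Fin ⌊M * F⌋₊ → ZMod 2) : ℝ) = 2 ^ (⌊M * F⌋₊ * s) := by
    simp [Fintype.card_pi, ← pow_mul]
  have e2 : ∀ k : ℕ, (2 : ℝ) ^ k = Real.exp (k * Real.log 2) := fun k => by
    rw [Real.exp_nat_mul, Real.exp_log two_pos]
  rw [hcard', e2, e2, Fintype.card_fin]
  nth_rewrite 1 [← Real.exp_log hK]
  rw [← Real.exp_nat_mul, ← Real.exp_add, ← Real.exp_add, Real.exp_le_exp]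
  have hfl : (⌊M * F⌋₊ : ℝ) ≤ M * F := Nat.floor_le (by positivity)
  have : (⌊M * F⌋₊ : ℝ) * s * Real.log 2 ≤ M * F * s * Real.log 2 :=
    mul_le_mul_of_nonneg_right (mul_le_mul_of_nonneg_right hfl (Nat.cast_nonneg _))
      (Real.log_pos one_lt_two).le
  push_cast
  linarith

/-- Single-request bound, averaged over the requests: by symmetry, a request of `σ` files needs
about a fraction `σ / (2 m)` of what is needed for all files. -/
theorem CachingScheme.ZeroError.le_sum_sum_length {n m L : ℕ} {M : ℝ} {F s : ℕ}
    {S : CachingScheme n m L M F} (hS : S.ZeroError) (hM : 0 ≤ M) (hsn : s ≤ n) (hs : 1 ≤ s)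
    (hL : 1 ≤ L) (hsM : s * M ≤ m) {a : ℝ} (ha : Real.log 2 < a) :
    (2 : ℝ) ^ (m * F) * ∑ d : Demand n m L, ((m - s * M) * F * Real.log 2 / a *
        ((firstFiles s d).card / (2 * m)) - Real.log (1 - 2 * Real.exp (-a))⁻¹ / a) ≤
      ∑ d : Demand n m L, ∑ W : Library m F, ((S.encode W d).length : ℝ) := by
  have ha0 : 0 < a := (Real.log_pos one_lt_two).trans ha
  set κ := Real.log (1 - 2 * Real.exp (-a))⁻¹ with hκ
  let Λ : Demand n m L → ℝ := fun d => ∑ W : Library m F, ((S.encode W d).length : ℝ)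
  let act : Equiv.Perm (Fin m) → Demand n m L → Demand n m L := fun π d u l => π (d u l)
  have hact : ∀ π, ∑ d, Λ (act π d) = ∑ d, Λ d := by
    intro π
    refine Fintype.sum_bijective (act π) ?_ _ _ (fun _ => rfl)
    refine Function.bijective_iff_has_inverse.2 ⟨act π.symm, fun d => ?_, fun d => ?_⟩ <;>
    · funext u l
      simp [act]
  -- The bound is shown for the average over the orbit of `d` under file permutations; summing over
  -- `d` then removes the average by `hact`.
  have key : ∀ d, (Fintype.card (Equiv.Perm (Fin m)) : ℝ) * ((2 : ℝ) ^ (m * F) *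
      ((m - s * M) * F * Real.log 2 / a * ((firstFiles s d).card / (2 * m)) - κ / a)) ≤
      ∑ π, Λ (act π d) := by
    intro d
    obtain ⟨t, ht1, htσ, htm, ρ, hρ⟩ :=
      exists_perms_cover _ (firstFiles_nonempty (hs.trans hsn) hL hs d)
    have hm : 0 < m := Fin.pos (d ⟨0, hs.trans hsn⟩ ⟨0, hL⟩)
    have hcov : ∀ π f, ∃ i, f ∈ firstFiles s (act π (act (ρ i) d)) := by
      intro π f
      obtain ⟨i, x, hx, hxf⟩ := hρ (π.symm f)
      obtain ⟨u, l, hu, rfl⟩ := mem_firstFiles.1 hx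
      refine ⟨i, mem_firstFiles.2 ⟨u, l, hu, ?_⟩⟩
      simp only [act]
      rw [hxf, Equiv.apply_symm_apply]
    have h1 := Finset.sum_le_sum fun π (_ : π ∈ (Finset.univ : Finset (Equiv.Perm (Fin m)))) =>
      hS.le_sum_length hM hsn ha _ (hcov π)
    rw [Finset.sum_const, Finset.card_univ, nsmul_eq_mul] at h1
    have h2 : ∑ π : Equiv.Perm (Fin m), ∑ W : Library m F, ∑ i : Fin t,
        ((S.encode W (act π (act (ρ i) d))).length : ℝ) = t * ∑ π, Λ (act π d) := by
      -- Right translation by `ρ i` permutes the group, so all `t` requests of the cover have the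
      -- same average cost.
      have : ∀ i : Fin t, ∑ π : Equiv.Perm (Fin m), Λ (act π (act (ρ i) d)) =
          ∑ π, Λ (act π d) := fun i =>
        Fintype.sum_equiv (Equiv.mulRight (ρ i)) _ _ (fun π => rfl)
      calc _ = ∑ i : Fin t, ∑ π : Equiv.Perm (Fin m), Λ (act π (act (ρ i) d)) := by
            rw [Finset.sum_comm]
            rw [Finset.sum_congr rfl fun W _ => Finset.sum_comm, Finset.sum_comm]
            exact Finset.sum_congr rfl fun i _ => Finset.sum_comm
        _ = _ := by simp [this]
    rw [h2, ← hκ] at h1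
    have ht0 : (0 : ℝ) < t := by exact_mod_cast ht1
    refine le_of_mul_le_mul_left (le_trans ?_ h1) ht0
    rw [mul_left_comm]
    refine mul_le_mul_of_nonneg_left ?_ (by positivity)
    rw [mul_left_comm]
    refine mul_le_mul_of_nonneg_left ?_ (by positivity)
    have h3 : (t : ℝ) * ((firstFiles s d).card / (2 * m)) ≤ 1 := by
      rw [← mul_div_assoc, div_le_one (by positivity)]
      exact_mod_cast htσ
    have h4 : 0 ≤ (m - s * M) * F * Real.log 2 / a := by
      have := (Real.log_pos one_lt_two).le
      have : 0 ≤ m - s * M := by linarith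
      positivity
    have := mul_le_mul_of_nonneg_left h3 h4
    rw [sub_div]
    linear_combination this
  have h := Finset.sum_le_sum fun d (_ : d ∈ (Finset.univ : Finset (Demand n m L))) => key d
  rw [← Finset.mul_sum, ← Finset.mul_sum, Finset.sum_comm,
    Finset.sum_congr rfl (fun π _ => hact π), Finset.sum_const, Finset.card_univ,
    nsmul_eq_mul] at h
  exact le_of_mul_le_mul_left h (by exact_mod_cast Fintype.card_pos)

/-- The worst library is at least as bad as the average one. Division by `F` turns the loss from
strings that are not prefix-free into a term of order `1 / F`. -/
theorem CachingScheme.ZeroError.le_rate {n m L : ℕ} {M : ℝ} {F s : ℕ} (hF : 1 ≤ F)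
    {S : CachingScheme n m L M F} (hS : S.ZeroError) (hM : 0 ≤ M) (hm : 1 ≤ m) (hsn : s ≤ n)
    (hs : 1 ≤ s) (hL : 1 ≤ L) (hsM : s * M ≤ m) {a : ℝ} (ha : Real.log 2 < a) :
    Real.log 2 / a * ((m - s * M) *
        (demandExp (zipf 0 m) (fun d : Demand n m L => ((firstFiles s d).card : ℝ)) / (2 * m))) -
      Real.log (1 - 2 * Real.exp (-a))⁻¹ / a / F ≤ S.rate (zipf 0 m) := by
  have h := hS.le_sum_sum_length hM hsn hs hL hsM ha
  have hsup : ∀ W : Library m F,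
      demandExp (zipf 0 m) (fun d => ((S.encode W d).length : ℝ)) / F ≤ S.rate (zipf 0 m) :=
    fun W => le_ciSup (f := fun W : Library m F =>
      demandExp (zipf 0 m) (fun d => ((S.encode W d).length : ℝ)) / F)
      (Set.finite_range _).bddAbove W
  have hsum := Finset.sum_le_sum fun W (_ : W ∈ (Finset.univ : Finset (Library m F))) => hsup W
  have hcard : (Fintype.card (Library m F) : ℝ) = 2 ^ (m * F) := by
    simp [Fintype.card_pi, ← pow_mul, mul_comm]
  rw [Finset.sum_const, Finset.card_univ, nsmul_eq_mul, hcard] at hsum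
  have hD : (Fintype.card (Demand n m L) : ℝ) = (m : ℝ) ^ (n * L) := by
    simp [Fintype.card_pi, ← pow_mul, mul_comm]
  simp only [demandExp_zipf_zero] at hsum ⊢
  rw [← Finset.sum_div, ← Finset.sum_div, Finset.sum_comm] at hsum
  rw [Finset.sum_sub_distrib, ← Finset.mul_sum, ← Finset.sum_div, Finset.sum_const,
    Finset.card_univ, nsmul_eq_mul, hD] at h
  have h2 : (0 : ℝ) < 2 ^ (m * F) := by positivity
  have hF0 : (0 : ℝ) < F := by exact_mod_cast hF
  have hm0 : (0 : ℝ) < m := by exact_mod_cast hm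
  have hmp : (0 : ℝ) < (m : ℝ) ^ (n * L) := by positivity
  have ha0 : 0 < a := (Real.log_pos one_lt_two).trans ha
  refine le_of_mul_le_mul_left (le_trans ?_ hsum) h2
  rw [le_div_iff₀ hF0, le_div_iff₀ hmp]
  refine le_trans (le_of_eq ?_) h
  field_simp

/-- Converse: `s` caches of size `M` leave a fraction `1 - s M / m` of the library unknown. -/
theorem Achievable.le {n m L : ℕ} {M R : ℝ} (hR : Achievable n m L M (zipf 0 m) R) {s : ℕ}
    (hM : 0 ≤ M) (hm : 1 ≤ m) (hsn : s ≤ n) (hs : 1 ≤ s) (hL : 1 ≤ L) (hsM : s * M ≤ m) :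
    (m - s * M) *
      (demandExp (zipf 0 m) (fun d : Demand n m L => ((firstFiles s d).card : ℝ)) / (2 * m)) ≤
      R := by
  obtain ⟨S, herr, hrate⟩ := hR
  set G := (m - s * M) *
    (demandExp (zipf 0 m) (fun d : Demand n m L => ((firstFiles s d).card : ℝ)) / (2 * m))
  have hm0 : (0 : ℝ) < m := by exact_mod_cast hm
  have hz : ∀ᶠ F in atTop, (S F).ZeroError :=
    (herr.eventually_lt_const (by positivity : (0 : ℝ) < 1 / (m : ℝ) ^ (n * L))).mono
      fun F hF => CachingScheme.zeroError_of_errorProb_lt hF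
  have h1 : ∀ a, Real.log 2 < a → ∀ ε : ℝ, 0 < ε → Real.log 2 / a * G ≤ R + ε := by
    intro a ha ε hε
    have hlim : Tendsto (fun F : ℕ => Real.log 2 / a * G -
        Real.log (1 - 2 * Real.exp (-a))⁻¹ / a / F) atTop (𝓝 (Real.log 2 / a * G - 0)) :=
      tendsto_const_nhds.sub (tendsto_const_div_atTop_nhds_zero_nat _)
    rw [sub_zero] at hlim
    refine le_of_tendsto hlim ?_
    filter_upwards [hz, hrate ε hε, eventually_ge_atTop 1] with F hF hr hF1
    exact (hF.le_rate hF1 hM hm hsn hs hL hsM ha).trans hr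
  have h2 : ∀ a, Real.log 2 < a → Real.log 2 / a * G ≤ R := fun a ha =>
    le_of_forall_pos_le_add (h1 a ha)
  have hl := Real.log_pos one_lt_two
  -- The Kraft sum requires `a > log 2`, so the sharp constant is reached only after `F → ∞`, in the
  -- limit `a → log 2`.
  have h3 : Tendsto (fun a => Real.log 2 / a * G) (𝓝[>] (Real.log 2))
      (𝓝 (Real.log 2 / Real.log 2 * G)) :=
    ((tendsto_const_nhds.div tendsto_id hl.ne').mul_const G).mono_left nhdsWithin_le_nhds
  rw [div_self hl.ne', one_mul] at h3
  exact le_of_tendsto h3 (eventually_nhdsWithin_of_forall fun a ha => h2 a ha)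

/-! ### Converse: number of requested files and choice of `s` -/

open scoped Classical in
theorem card_notMem_firstFiles {n m L s : ℕ} (hsn : s ≤ n) (f : Fin m) :
    ((Finset.univ.filter fun d : Demand n m L => f ∉ firstFiles s d).card : ℝ) =
      ((m : ℝ) - 1) ^ (s * L) * (m : ℝ) ^ ((n - s) * L) := by
  have h : (Finset.univ.filter fun d : Demand n m L => f ∉ firstFiles s d) =
      Fintype.piFinset fun u : Fin n => Fintype.piFinset fun _ : Fin L =>
        if u.val < s then Finset.univ.erase f else Finset.univ := by
    ext d
    simp only [Finset.mem_filter, Finset.mem_univ, true_and, mem_firstFiles, Fintype.mem_piFinset]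
    push Not
    refine forall_congr' fun u => forall_congr' fun l => ?_
    by_cases hu : u.val < s <;> simp [hu]
  have hm : 1 ≤ m := Fin.pos f
  have hf : (Finset.univ.filter fun u : Fin n => u.val < s).card = s := by
    have : (Finset.univ.filter fun u : Fin n => u.val < s) =
        (Finset.univ : Finset (Fin s)).map (Fin.castLEEmb hsn) := by
      ext x
      simp only [Finset.mem_filter, Finset.mem_univ, true_and, Finset.mem_map]
      exact ⟨fun h => ⟨⟨x, h⟩, rfl⟩, by rintro ⟨y, rfl⟩; exact y.2⟩
    rw [this, Finset.card_map, Finset.card_univ, Fintype.card_fin]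
  have hf' : (Finset.univ.filter fun u : Fin n => ¬ u.val < s).card = n - s := by
    rw [← Finset.compl_filter, Finset.card_compl, hf, Fintype.card_fin]
  rw [h, Fintype.card_piFinset]
  simp only [Fintype.card_piFinset, Finset.prod_const, Finset.card_univ, Fintype.card_fin]
  have hc : ∀ u : Fin n, (if u.val < s then Finset.univ.erase f else Finset.univ).card ^ L =
      if u.val < s then (m - 1) ^ L else m ^ L := by
    intro u
    split_ifs <;> simp
  rw [Finset.prod_congr rfl fun u _ => hc u, Finset.prod_ite, Finset.prod_const, Finset.prod_const,
    hf, hf', ← pow_mul, ← pow_mul, mul_comm L, mul_comm L]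
  push_cast [hm]
  rfl

/-- The first `s` users together request at least `min (s L) m / 2` files on average. -/
theorem le_demandExp_card_firstFiles {n m L s : ℕ} (hm : 1 ≤ m) (hsn : s ≤ n) :
    min ((s : ℝ) * L) m / 2 ≤
      demandExp (zipf 0 m) (fun d : Demand n m L => ((firstFiles s d).card : ℝ)) := by
  classical
  have hm0 : (0 : ℝ) < m := by exact_mod_cast hm
  have hm1 : (1 : ℝ) ≤ m := by exact_mod_cast hm
  have h1 : ∀ d : Demand n m L, ((firstFiles s d).card : ℝ) =
      ∑ f, (1 - if f ∉ firstFiles s d then (1 : ℝ) else 0) := by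
    intro d
    have e : ∀ f, (1 - if f ∉ firstFiles s d then (1 : ℝ) else 0) =
        if f ∈ firstFiles s d then 1 else 0 := by
      intro f
      by_cases hf : f ∈ firstFiles s d <;> simp [hf]
    rw [Finset.sum_congr rfl fun f _ => e f]
    simp
  have hD : (Fintype.card (Demand n m L) : ℝ) = (m : ℝ) ^ (n * L) := by
    simp [Fintype.card_pi, ← pow_mul, mul_comm]
  have h2 : demandExp (zipf 0 m) (fun d : Demand n m L => ((firstFiles s d).card : ℝ)) =
      m * (1 - (1 - 1 / (m : ℝ)) ^ (s * L)) := by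
    rw [demandExp_zipf_zero]
    simp only [h1]
    rw [Finset.sum_comm]
    simp only [Finset.sum_sub_distrib, Finset.sum_boole, card_notMem_firstFiles hsn,
      Finset.sum_const, Finset.card_univ, nsmul_eq_mul, mul_one, hD, Fintype.card_fin]
    have hsp : (m : ℝ) ^ (n * L) = m ^ (s * L) * m ^ ((n - s) * L) := by
      rw [← pow_add, ← add_mul, Nat.add_sub_cancel' hsn]
    have hq : (1 - 1 / (m : ℝ)) ^ (s * L) = ((m : ℝ) - 1) ^ (s * L) / m ^ (s * L) := by
      rw [← div_pow]
      congr 1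
      field_simp
    rw [hsp, hq]
    field_simp
  rw [h2]
  set N := s * L with hN
  have hN' : (s : ℝ) * L = N := by rw [hN]; push_cast; rfl
  rw [hN']
  set x := (1 - 1 / (m : ℝ)) ^ N with hx
  have hinv : 1 / (m : ℝ) ≤ 1 := by rw [div_le_one hm0]; exact hm1
  have hx0 : 0 ≤ x := pow_nonneg (by linarith) _
  -- Bernoulli's inequality, with `(1 - 1 / m) * (1 + 1 / m) ≤ 1`, gives `x ≤ m / (m + N)`. Hence `m
  -- * (1 - x) ≥ m * N / (m + N) ≥ min N m / 2`.
  have hb : 1 + (N : ℝ) * (1 / m) ≤ (1 + 1 / (m : ℝ)) ^ N :=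
    one_add_mul_le_pow (by have : (0 : ℝ) ≤ 1 / m := by positivity
                           linarith) N
  have hxy : x * (1 + 1 / (m : ℝ)) ^ N ≤ 1 := by
    rw [hx, ← mul_pow]
    have : (0 : ℝ) ≤ 1 / m := by positivity
    exact pow_le_one₀ (mul_nonneg (by linarith) (by linarith)) (by nlinarith)
  have h3 : x * (1 + (N : ℝ) * (1 / m)) ≤ 1 := (mul_le_mul_of_nonneg_left hb hx0).trans hxy
  have h4 : x * (m + N) ≤ m := by
    have := mul_le_mul_of_nonneg_left h3 hm0.le
    have e : (m : ℝ) * (x * (1 + (N : ℝ) * (1 / m))) = x * (m + N) := by field_simp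
    linarith
  have hN0 : (0 : ℝ) ≤ N := Nat.cast_nonneg _
  have hx1 : x ≤ 1 := pow_le_one₀ (by linarith) (by
    have : (0 : ℝ) ≤ 1 / m := by positivity
    linarith)
  rcases le_total (N : ℝ) m with h | h
  · rw [min_eq_left h]
    nlinarith
  · rw [min_eq_right h]
    nlinarith

/-- The converse matches the upper bound up to a constant. -/
theorem Achievable.min_le {n m L : ℕ} {M R : ℝ} (hR : Achievable n m L M (zipf 0 m) R)
    (hn : 1 ≤ n) (hL : 1 ≤ L) (hM : 0 < M) (hMm : M ≤ m) :
    min ((L : ℝ) * ((m : ℝ) / M - 1)) (min ((L : ℝ) * n) ((m : ℝ) - M)) ≤ 32 * R := by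
  have hm0 : (0 : ℝ) < m := hM.trans_le hMm
  have hm : 1 ≤ m := by exact_mod_cast hm0
  have hL1 : (1 : ℝ) ≤ L := by exact_mod_cast hL
  have hn1 : (1 : ℝ) ≤ n := by exact_mod_cast hn
  have key : ∀ s : ℕ, s ≤ n → 1 ≤ s → s * M ≤ m →
      (1 - s * M / m) * min ((s : ℝ) * L) m ≤ 4 * R := by
    intro s hsn hs hsM
    have h := hR.le hM.le hm hsn hs hL hsM
    have h' := le_demandExp_card_firstFiles (n := n) (L := L) hm hsn
    set E := demandExp (zipf 0 m) (fun d : Demand n m L => ((firstFiles s d).card : ℝ))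
    have h0 : 0 ≤ 1 - s * M / m := by
      rw [sub_nonneg, div_le_one hm0]
      exact hsM
    have e : ((m : ℝ) - s * M) * (E / (2 * m)) = (1 - s * M / m) * (E / 2) := by
      field_simp
    rw [e] at h
    have := mul_le_mul_of_nonneg_left h' h0
    linarith
  -- Large caches: a single user suffices, as `m / M ≤ 4`. Small caches: `s = min n ⌊m / (2 * M)⌋`
  -- leaves at least half of the library unknown, so `min (s * L) m ≤ 8 * R`.
  rcases le_total (m : ℝ) (4 * M) with h4 | h4
  · have h := key 1 hn le_rfl (by simpa using hMm)
    simp only [Nat.cast_one, one_mul] at h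
    rcases le_total (L : ℝ) m with hLm | hLm
    · rw [min_eq_left hLm] at h
      refine (min_le_left _ _).trans ?_
      have e : (L : ℝ) * ((m : ℝ) / M - 1) = (m / M) * ((1 - M / m) * L) := by
        field_simp
      have h5 : (m : ℝ) / M ≤ 4 := by rwa [div_le_iff₀ hM]
      have h6 : 0 ≤ (1 - M / m) * (L : ℝ) :=
        mul_nonneg (by rw [sub_nonneg, div_le_one hm0]; exact hMm) (by linarith)
      rw [e]
      nlinarith
    · rw [min_eq_right hLm] at h
      refine ((min_le_right _ _).trans (min_le_right _ _)).trans ?_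
      have e : (1 - M / m) * m = m - M := by field_simp
      rw [e] at h
      linarith
  · have hx : 2 ≤ (m : ℝ) / (2 * M) := by
      rw [le_div_iff₀ (by positivity)]
      linarith
    have hfl : 1 ≤ ⌊(m : ℝ) / (2 * M)⌋₊ := Nat.le_floor (by push_cast; linarith)
    have h := key (min n ⌊(m : ℝ) / (2 * M)⌋₊) (min_le_left _ _) (le_min hn hfl)
    set s := min n ⌊(m : ℝ) / (2 * M)⌋₊ with hs
    have hsf : (s : ℝ) ≤ m / (2 * M) :=
      (Nat.cast_le.2 (min_le_right _ _)).trans (Nat.floor_le (by positivity))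
    have hsM : (s : ℝ) * M ≤ m / 2 := by
      rw [le_div_iff₀ (by positivity)] at hsf
      linarith
    have h := h (by linarith)
    have hhalf : 1 / 2 ≤ 1 - s * M / m := by
      have : s * M / m ≤ 1 / 2 := by
        rw [div_le_iff₀ hm0]
        linarith
      linarith
    have h8 : min ((s : ℝ) * L) m ≤ 8 * R := by
      have : 0 ≤ min ((s : ℝ) * L) m := le_min (by positivity) hm0.le
      nlinarith
    rcases min_le_iff.1 h8 with h9 | h9
    · rcases min_choice n ⌊(m : ℝ) / (2 * M)⌋₊ with hc | hc
      · refine ((min_le_right _ _).trans (min_le_left _ _)).trans ?_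
        rw [hs, hc] at h9
        have : 0 ≤ (n : ℝ) * L := by positivity
        linarith
      · refine (min_le_left _ _).trans ?_
        have hlt := Nat.lt_floor_add_one ((m : ℝ) / (2 * M))
        -- Since `m / (2 * M) ≥ 2`, rounding down loses at most half. The resulting factor 4 in `m /
        -- M ≤ 4 * s` turns `8 * R` into `32 * R`.
        have h10 : (m : ℝ) / (4 * M) ≤ s := by
          rw [hs, hc]
          have : (m : ℝ) / (4 * M) = m / (2 * M) / 2 := by
            field_simp
            norm_num
          linarith
        have e : (m : ℝ) / M = 4 * (m / (4 * M)) := by field_simp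
        have := mul_le_mul_of_nonneg_right h10 (by linarith : (0 : ℝ) ≤ L)
        have h11 : 0 ≤ (s : ℝ) * L := by positivity
        rw [e]
        nlinarith
    · refine ((min_le_right _ _).trans (min_le_right _ _)).trans ?_
      linarith

/-! ### Number of colors for a given placement -/

section Greedy

variable {n m L B : ℕ} {C : Placement n m B}

theorem mem_label_self (v : Vertex n m B) : v.1 ∈ label C v := by
  simp [label]

theorem mem_label {v : Vertex n m B} {u : Fin n} :
    u ∈ label C v ↔ u = v.1 ∨ Cached C u v.2 := by
  simp [label]

/-- Vertices with a common label that belong to different users do not conflict. -/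
theorem not_adj_of_label_eq {v w : Vertex n m B} (h : label C v = label C w) (hne : v.1 ≠ w.1) :
    ¬ (conflictGraph C).Adj v w := by
  intro hadj
  have : v.1 ∈ label C w := h ▸ mem_label_self v
  exact (mem_label.1 this).elim hne hadj.1

open scoped Classical in
/-- The number of vertices of `U` with label `T` that belong to user `u`. -/
def labelCount (C : Placement n m B) (U : Finset (Vertex n m B)) (T : Finset (Fin n))
    (u : Fin n) : ℕ :=
  (U.filter fun v => label C v = T ∧ v.1 = u).card

theorem labelCount_mono {U V : Finset (Vertex n m B)} (h : U ⊆ V) (T : Finset (Fin n))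
    (u : Fin n) : labelCount C U T u ≤ labelCount C V T u :=
  Finset.card_le_card (Finset.filter_subset_filter _ h)

/-- The greedy coloring uses, for every label, at most the largest number of vertices with that
label that belong to one user. -/
theorem IsGreedyColoring.card_le {U : Finset (Vertex n m B)} {P : Finset (Finset (Vertex n m B))}
    (h : IsGreedyColoring C U P) :
    P.card ≤ ∑ T : Finset (Fin n), Finset.univ.sup (labelCount C U T) := by
  classical
  induction h with
  | nil => simp
  | step U I P v hIU hv hlabel hindep hmax hrest ih =>
    refine (Finset.card_insert_le _ _).trans ((Nat.add_le_add_right ih 1).trans ?_)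
    rw [Nat.succ_le_iff]
    refine Finset.sum_lt_sum (fun T _ => Finset.sup_mono_fun fun u _ =>
      labelCount_mono Finset.sdiff_subset T u) ⟨label C v, Finset.mem_univ _, ?_⟩
    have hpos : ∀ u, 0 < labelCount C U (label C v) u →
        labelCount C (U \ I) (label C v) u < labelCount C U (label C v) u := by
      intro u hu
      -- A class that missed user `u` could be enlarged by any vertex of `u` with this label,
      -- against maximality. Each class thus lowers every positive count, and hence the maximum.
      have hex : ∃ w ∈ I, w.1 = u := by
        by_contra hno
        push Not at hno
        obtain ⟨w, hw⟩ := Finset.card_pos.1 hu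
        obtain ⟨hwU, hwl, rfl⟩ := Finset.mem_filter.1 hw
        obtain ⟨w', hw'I, hadj⟩ := hmax w hwU (fun hwI => hno w hwI rfl) hwl
        have hl : label C w' = label C w := (hlabel w' hw'I).trans hwl.symm
        exact hadj.elim (not_adj_of_label_eq hl.symm (hno w' hw'I).symm)
          (not_adj_of_label_eq hl (hno w' hw'I))
      obtain ⟨w, hwI, rfl⟩ := hex
      refine Finset.card_lt_card (Finset.ssubset_iff_subset_ne.2
        ⟨Finset.filter_subset_filter _ Finset.sdiff_subset, fun heq => ?_⟩)
      have hmem : w ∈ U.filter fun x => label C x = label C v ∧ x.1 = w.1 :=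
        Finset.mem_filter.2 ⟨hIU hwI, hlabel w hwI, rfl⟩
      rw [← heq] at hmem
      exact (Finset.mem_sdiff.1 (Finset.mem_filter.1 hmem).1).2 hwI
    have hvpos : 0 < labelCount C U (label C v) v.1 :=
      Finset.card_pos.2 ⟨v, Finset.mem_filter.2 ⟨hIU hv, rfl, rfl⟩⟩
    have hsup : 0 < Finset.univ.sup (labelCount C U (label C v)) :=
      hvpos.trans_le (Finset.le_sup (Finset.mem_univ v.1))
    refine (Finset.sup_lt_iff hsup).2 fun u _ => ?_
    rcases Nat.eq_zero_or_pos (labelCount C U (label C v) u) with h0 | h0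
    · exact ((labelCount_mono Finset.sdiff_subset _ u).trans h0.le).trans_lt hsup
    · exact (hpos u h0).trans_le (Finset.le_sup (Finset.mem_univ u))

open scoped Classical in
/-- The packets of file `f` that are cached by exactly the users in `S`. -/
def exactlyCached (C : Placement n m B) (f : Fin m) (S : Finset (Fin n)) : Finset (Fin B) :=
  {j | ∀ u, j ∈ C u f ↔ u ∈ S}

theorem labelCount_vertices_eq_zero (d : Demand n m L) {T : Finset (Fin n)} {u : Fin n}
    (hu : u ∉ T) : labelCount C (vertices C d) T u = 0 := by
  classical
  refine Finset.card_eq_zero.2 (Finset.filter_eq_empty_iff.2 ?_)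
  rintro v - ⟨rfl, rfl⟩
  exact hu (mem_label_self v)

/-- A packet needed by `u` at a vertex with label `T` is cached by exactly the users in `T \ {u}`.
Repeated requests of one file only enlarge the sum. -/
theorem labelCount_vertices_le (d : Demand n m L) {T : Finset (Fin n)} {u : Fin n}
    (hu : u ∈ T) : labelCount C (vertices C d) T u ≤
      ∑ l, (exactlyCached C (d u l) (T.erase u)).card := by
  classical
  have hsub : ((vertices C d).filter fun v => label C v = T ∧ v.1 = u) ⊆
      Finset.univ.biUnion fun l => (exactlyCached C (d u l) (T.erase u)).image
        fun j => (u, (d u l, j)) := by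
    rintro ⟨u', f, j⟩ hv
    obtain ⟨hvU, hT, hu'⟩ := Finset.mem_filter.1 hv
    obtain rfl : u' = u := hu'
    obtain ⟨⟨l, hl⟩, hc⟩ := (Finset.mem_filter.1 hvU).2
    obtain rfl : d u' l = f := hl
    refine Finset.mem_biUnion.2 ⟨l, Finset.mem_univ _, Finset.mem_image.2 ⟨j, ?_, rfl⟩⟩
    simp only [exactlyCached, Finset.mem_filter, Finset.mem_univ, true_and, Finset.mem_erase, ← hT,
      mem_label]
    intro u
    constructor
    · intro hj
      refine ⟨?_, Or.inr hj⟩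
      rintro rfl
      exact hc hj
    · rintro ⟨hne, h | h⟩
      · exact absurd h hne
      · exact h
  refine (Finset.card_le_card hsub).trans (Finset.card_biUnion_le.trans ?_)
  exact Finset.sum_le_sum fun l _ => Finset.card_image_le

theorem localColors_le_card (C : Placement n m B) (d : Demand n m L)
    (P : Finset (Finset (Vertex n m B))) : localColors C d P ≤ P.card := by
  classical
  exact Finset.sup_le fun _ _ => Finset.card_filter_le _ _

theorem GreedyRule.transmissions_le_greedy (g : GreedyRule) (C : Placement n m B)
    (d : Demand n m L) : g.transmissions C d ≤ (g.classes C d).card := by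
  rw [transmissions, gclc]
  split_ifs with h
  · exact localColors_le_card _ _ _
  · exact (not_le.1 h).le.trans (localColors_le_card _ _ _)

theorem GreedyRule.transmissions_le_packet (g : GreedyRule) (C : Placement n m B)
    (d : Demand n m L) : g.transmissions C d ≤ localColors C d (packetColoring C d) := by
  rw [transmissions, gclc]
  split_ifs with h
  · exact h
  · exact le_rfl

theorem IsGreedyColoring.card_le_card {U : Finset (Vertex n m B)}
    {P : Finset (Finset (Vertex n m B))} (h : IsGreedyColoring C U P) : P.card ≤ U.card := by
  classical
  induction h with
  | nil => simp
  | step U I P v hIU hv _ _ _ _ ih =>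
    have h1 := Finset.card_sdiff_add_card_eq_card hIU
    have h2 : 0 < I.card := Finset.card_pos.2 ⟨v, hv⟩
    have h3 := Finset.card_insert_le I P
    omega

theorem card_vertices_le (C : Placement n m B) (d : Demand n m L) :
    (vertices C d).card ≤ L * n * B := by
  classical
  have hsub : vertices C d ⊆ (Finset.univ : Finset (Fin n × Fin L × Fin B)).image
      fun x => (x.1, (d x.1 x.2.1, x.2.2)) := by
    rintro ⟨u, f, j⟩ hv
    obtain ⟨⟨l, hl⟩, -⟩ := (Finset.mem_filter.1 hv).2
    obtain rfl : d u l = f := hl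
    exact Finset.mem_image.2 ⟨(u, l, j), Finset.mem_univ _, rfl⟩
  refine (Finset.card_le_card hsub).trans (Finset.card_image_le.trans ?_)
  simp only [Finset.card_univ, Fintype.card_prod, Fintype.card_fin]
  exact le_of_eq (by ring)

theorem GreedyRule.transmissions_le_mul (g : GreedyRule) (C : Placement n m B)
    (d : Demand n m L) : g.transmissions C d ≤ L * n * B :=
  (g.transmissions_le_greedy C d).trans
    ((g.isGreedy C d).card_le_card.trans (card_vertices_le C d))

/-- With the packet coloring, a user sees at most one color for every packet it does not cache. -/
theorem localColors_packetColoring_le (C : Placement n m B) (d : Demand n m L) {k : ℕ}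
    (hC : ∀ u f, (C u f).card = k) : localColors C d (packetColoring C d) ≤ m * (B - k) := by
  classical
  refine Finset.sup_le fun v hv => ?_
  have hvc := (Finset.mem_filter.1 hv).2.2
  have hsub : ((packetColoring C d).filter fun I => ∃ w ∈ I, w = v ∨ (conflictGraph C).Adj v w) ⊆
      ((Finset.univ : Finset (Fin m)).sigma fun f => (C v.1 f)ᶜ).image
        fun p => (vertices C d).filter fun w => w.2 = (p.1, p.2) := by
    intro I hI
    obtain ⟨hI, w, hwI, hw⟩ := Finset.mem_filter.1 hI
    obtain ⟨x, hx, rfl⟩ := Finset.mem_image.1 hI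
    have hwx : w.2 = x.2 := (Finset.mem_filter.1 hwI).2
    have hnc : ¬ Cached C v.1 x.2 := by
      rw [← hwx]
      rcases hw with rfl | hw
      · exact hvc
      · exact hw.1
    refine Finset.mem_image.2 ⟨⟨x.2.1, x.2.2⟩, ?_, rfl⟩
    exact Finset.mem_sigma.2 ⟨Finset.mem_univ _, Finset.mem_compl.2 hnc⟩
  refine (Finset.card_le_card hsub).trans (Finset.card_image_le.trans ?_)
  rw [Finset.card_sigma]
  simp [Finset.card_compl, hC]

/-- If every exact caching pattern is about as frequent as expected, then the greedy coloring needs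
about `L (1 - p) / p` colors, normalized. -/
theorem GreedyRule.transmissions_le_of_card_le (g : GreedyRule) (C : Placement n m B)
    (d : Demand n m L) {p δ : ℝ} (hp : 0 < p) (hp1 : p ≤ 1) (hδ : 0 ≤ δ)
    (hC : ∀ f S, ((exactlyCached C f S).card : ℝ) ≤
      (p ^ S.card * (1 - p) ^ (n - S.card) + δ) * B) :
    (g.transmissions C d : ℝ) ≤ L * ((1 - p) / p + 2 ^ n * δ) * B := by
  classical
  have h1 := (g.transmissions_le_greedy C d).trans (g.isGreedy C d).card_le
  have h1' : (g.transmissions C d : ℝ) ≤ ∑ T : Finset (Fin n),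
      ((Finset.univ.sup (labelCount C (vertices C d) T) : ℕ) : ℝ) := by exact_mod_cast h1
  have hq : 0 ≤ 1 - p := by linarith
  have h2 : ∀ T : Finset (Fin n),
      ((Finset.univ.sup (labelCount C (vertices C d) T) : ℕ) : ℝ) ≤
        L * (((1 - p) / p) * (p ^ T.card * (1 - p) ^ (n - T.card)) + δ) * B := by
    intro T
    have hb : 0 ≤ L * (((1 - p) / p) * (p ^ T.card * (1 - p) ^ (n - T.card)) + δ) * B := by
      have := div_nonneg hq hp.le
      have := pow_nonneg hq (n - T.card)
      positivity
    -- Passing to the floor allows the maximum to be bounded inside `ℕ`.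
    rw [← Nat.le_floor_iff hb]
    refine Finset.sup_le fun u _ => ?_
    rw [Nat.le_floor_iff hb]
    by_cases hu : u ∈ T
    · have h3 : (labelCount C (vertices C d) T u : ℝ) ≤
          ∑ l, ((exactlyCached C (d u l) (T.erase u)).card : ℝ) := by
        exact_mod_cast labelCount_vertices_le d hu
      refine h3.trans ((Finset.sum_le_sum fun l _ => hC _ _).trans (le_of_eq ?_))
      have hT : 1 ≤ T.card := Finset.card_pos.2 ⟨u, hu⟩
      have hTn : T.card ≤ n := by simpa using T.card_le_univ
      rw [Finset.card_erase_of_mem hu, Finset.sum_const, Finset.card_univ, Fintype.card_fin,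
        nsmul_eq_mul]
      obtain ⟨k, hk⟩ := Nat.exists_eq_add_of_le' hT
      -- Removing `u` from `T` trades one factor `p` for one factor `1 - p`; this is the source of
      -- the ratio `(1 - p) / p`.
      rw [hk, Nat.add_sub_cancel, show n - k = (n - (k + 1)) + 1 by omega, pow_succ, pow_succ]
      field_simp
    · rw [labelCount_vertices_eq_zero d hu]
      simpa using hb
  refine h1'.trans ((Finset.sum_le_sum fun T _ => h2 T).trans (le_of_eq ?_))
  rw [← Finset.sum_mul, ← Finset.mul_sum, Finset.sum_add_distrib, ← Finset.mul_sum]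
  have := Fintype.sum_pow_mul_eq_add_pow (Fin n) p (1 - p)
  rw [Fintype.card_fin] at this
  rw [this]
  simp

end Greedy

/-! ### Concentration of the caching patterns -/

theorem card_mem_powersetCard {B k : ℕ} (j : Fin B) :
    (((Finset.univ : Finset (Fin B)).powersetCard k).filter fun A => j ∈ A).card * B =
      B.choose k * k := by
  have hB : 0 < B := Fin.pos j
  rcases Nat.eq_zero_or_pos k with rfl | hk
  · simp
  · have h := Finset.card_filter_powersetCard_subset {j} (Finset.univ : Finset (Fin B)) k
      (by simp)
    simp only [Finset.singleton_subset_iff, Finset.card_univ, Fintype.card_fin,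
      Finset.card_singleton] at h
    rw [h hk]
    obtain ⟨b, rfl⟩ := Nat.exists_eq_add_of_le' hB
    obtain ⟨r, rfl⟩ := Nat.exists_eq_add_of_le' hk
    simp only [Nat.add_sub_cancel]
    rw [← Nat.add_one_mul_choose_eq, mul_comm]

/-- Sampling without replacement is negatively correlated: `k (k - 1) / (B (B - 1)) ≤ (k / B) ^ 2`.
An inequality is enough for a variance bound. -/
theorem card_mem_mem_powersetCard {B k : ℕ} (hk : k ≤ B) {i j : Fin B} (hij : i ≠ j) :
    (((Finset.univ : Finset (Fin B)).powersetCard k).filter fun A => i ∈ A ∧ j ∈ A).card * (B * B) ≤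
      B.choose k * (k * k) := by
  have hB : 2 ≤ B := by
    have := i.2
    have := j.2
    have : i.val ≠ j.val := fun h => hij (Fin.ext h)
    omega
  rcases Nat.lt_or_ge k 2 with hk2 | hk2
  · have : ((Finset.univ : Finset (Fin B)).powersetCard k).filter (fun A => i ∈ A ∧ j ∈ A) = ∅ := by
      refine Finset.filter_eq_empty_iff.2 fun A hA hmem => ?_
      have h1 : ({i, j} : Finset (Fin B)) ⊆ A := by
        intro x hx
        rcases Finset.mem_insert.1 hx with rfl | hx
        · exact hmem.1
        · rw [Finset.mem_singleton.1 hx]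
          exact hmem.2
      have h2 := Finset.card_le_card h1
      rw [Finset.card_pair hij, (Finset.mem_powersetCard.1 hA).2] at h2
      omega
    simp [this]
  · have h := Finset.card_filter_powersetCard_subset {i, j} (Finset.univ : Finset (Fin B)) k
      (by simp)
    simp only [Finset.insert_subset_iff, Finset.singleton_subset_iff, Finset.card_univ,
      Fintype.card_fin, Finset.card_pair hij] at h
    rw [h hk2]
    obtain ⟨b, rfl⟩ := Nat.exists_eq_add_of_le' hB
    obtain ⟨r, rfl⟩ := Nat.exists_eq_add_of_le' hk2
    simp only [Nat.add_sub_cancel]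
    have h1 := Nat.add_one_mul_choose_eq b r
    have h2 := Nat.add_one_mul_choose_eq (b + 1) (r + 1)
    have hrb : r ≤ b := by omega
    refine le_of_mul_le_mul_left ?_ (show 0 < b + 1 from Nat.succ_pos b)
    calc (b + 1) * (b.choose r * ((b + 2) * (b + 2)))
        = (b + 2) * ((b + 2) * ((b + 1) * b.choose r)) := by ring
      _ = (b + 2) * (r + 1) * ((b + 1 + 1) * (b + 1).choose (r + 1)) := by rw [h1]; ring
      _ = (b + 2) * (r + 1) * ((b + 2).choose (r + 2) * (r + 2)) := by rw [h2]
      _ ≤ (b + 1) * (r + 2) * ((b + 2).choose (r + 2) * (r + 2)) := by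
          refine Nat.mul_le_mul_right _ ?_
          nlinarith
      _ = _ := by ring

/-- The placements in which every user caches `k` packets of every file. -/
def placementsOfCard (n m B k : ℕ) : Finset (Placement n m B) :=
  Fintype.piFinset fun _ => Fintype.piFinset fun _ => (Finset.univ : Finset (Fin B)).powersetCard k

theorem card_placementsOfCard (n m B k : ℕ) :
    (placementsOfCard n m B k).card = ((B.choose k) ^ m) ^ n := by
  simp [placementsOfCard]

/-- Independence of the caches of different users. -/
theorem sum_placementsOfCard_prod {n m B k : ℕ} (f : Fin m)
    (φ : Fin n → Finset (Fin B) → ℝ) :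
    ∑ C ∈ placementsOfCard n m B k, ∏ u, φ u (C u f) =
      ∏ u, ((∑ A ∈ (Finset.univ : Finset (Fin B)).powersetCard k, φ u A) *
        (B.choose k : ℝ) ^ (m - 1)) := by
  classical
  rw [placementsOfCard, ← Finset.prod_univ_sum (fun _ : Fin n => Fintype.piFinset fun _ : Fin m =>
    (Finset.univ : Finset (Fin B)).powersetCard k) (fun u c => φ u (c f))]
  refine Finset.prod_congr rfl fun u _ => ?_
  have h1 : ∀ c : Fin m → Finset (Fin B), φ u (c f) =
      ∏ f', if f' = f then φ u (c f') else 1 := fun c => by simp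
  rw [Finset.sum_congr rfl fun c _ => h1 c, ← Finset.prod_univ_sum (fun _ : Fin m =>
    (Finset.univ : Finset (Fin B)).powersetCard k) (fun f' A => if f' = f then φ u A else 1),
    ← Finset.mul_prod_erase _ _ (Finset.mem_univ f)]
  congr 1
  · simp
  · rw [Finset.prod_congr rfl (g := fun _ => (B.choose k : ℝ))]
    · simp
    · intro f' hf'
      rw [Finset.sum_congr rfl (g := fun _ => (1 : ℝ))
        (fun A _ => if_neg (Finset.ne_of_mem_erase hf'))]
      simp

/-- The indicator of packet `j` of file `f` being cached by exactly the users in `S`. -/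
def exactInd {n B : ℕ} (S : Finset (Fin n)) (j : Fin B) (u : Fin n) (A : Finset (Fin B)) : ℝ :=
  open scoped Classical in if (j ∈ A ↔ u ∈ S) then 1 else 0

theorem card_exactlyCached_eq_sum {n m B : ℕ} (C : Placement n m B) (f : Fin m)
    (S : Finset (Fin n)) :
    ((exactlyCached C f S).card : ℝ) = ∑ j, ∏ u, exactInd S j u (C u f) := by
  classical
  simp only [exactInd, Finset.prod_boole, exactlyCached, Finset.sum_boole, Finset.mem_univ,
    true_imp_iff]

theorem sum_exactInd {n B k : ℕ} (S : Finset (Fin n)) (j : Fin B) (u : Fin n) :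
    ∑ A ∈ (Finset.univ : Finset (Fin B)).powersetCard k, exactInd S j u A =
      B.choose k * if u ∈ S then (k : ℝ) / B else 1 - k / B := by
  classical
  have hB : (0 : ℝ) < B := by exact_mod_cast Fin.pos j
  have h1 : ((((Finset.univ : Finset (Fin B)).powersetCard k).filter fun A => j ∈ A).card : ℝ) =
      B.choose k * (k / B) := by
    rw [← mul_div_assoc, eq_div_iff hB.ne']
    exact_mod_cast card_mem_powersetCard j
  by_cases hu : u ∈ S
  · simp [exactInd, hu, h1]
  · have h2 := Finset.card_filter_add_card_filter_not
      (s := (Finset.univ : Finset (Fin B)).powersetCard k) (fun A => j ∈ A)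
    rw [Finset.card_powersetCard, Finset.card_univ, Fintype.card_fin] at h2
    have h3 : ((((Finset.univ : Finset (Fin B)).powersetCard k).filter
        fun A => j ∈ A).card : ℝ) + (((Finset.univ : Finset (Fin B)).powersetCard k).filter
        fun A => j ∉ A).card = B.choose k := by exact_mod_cast h2
    simp only [exactInd, hu, iff_false, Finset.sum_boole, if_false]
    linarith

/-- Both packets must be cached by `u`, or both must be absent. Complementing both events preserves
their covariance, so the negative correlation covers both cases. -/
theorem sum_exactInd_mul_le {n B k : ℕ} (hk : k ≤ B) (S : Finset (Fin n)) {i j : Fin B}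
    (hij : i ≠ j) (u : Fin n) :
    ∑ A ∈ (Finset.univ : Finset (Fin B)).powersetCard k, exactInd S i u A * exactInd S j u A ≤
      B.choose k * (if u ∈ S then (k : ℝ) / B else 1 - k / B) ^ 2 := by
  classical
  have hB : (0 : ℝ) < B := by exact_mod_cast Fin.pos j
  let x : Fin B → Finset (Fin B) → ℝ := fun j A => if j ∈ A then 1 else 0
  have hx1 : ∀ j, ∑ A ∈ (Finset.univ : Finset (Fin B)).powersetCard k, x j A =
      B.choose k * (k / B) := by
    intro j
    simp only [x, Finset.sum_boole]
    rw [← mul_div_assoc, eq_div_iff hB.ne']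
    exact_mod_cast card_mem_powersetCard j
  have hx2 : ∑ A ∈ (Finset.univ : Finset (Fin B)).powersetCard k, x i A * x j A ≤
      B.choose k * (k / B) ^ 2 := by
    have e : ∀ A, x i A * x j A = if i ∈ A ∧ j ∈ A then 1 else 0 := by
      intro A
      by_cases h1 : i ∈ A <;> by_cases h2 : j ∈ A <;> simp [x, h1, h2]
    simp only [e, Finset.sum_boole]
    rw [div_pow, ← mul_div_assoc, le_div_iff₀ (by positivity), sq, sq]
    exact_mod_cast card_mem_mem_powersetCard hk hij
  by_cases hu : u ∈ S
  · simpa [exactInd, hu, x] using hx2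
  · have e : ∀ A, exactInd S i u A * exactInd S j u A = 1 - x i A - x j A + x i A * x j A := by
      intro A
      by_cases h1 : i ∈ A <;> by_cases h2 : j ∈ A <;> simp [exactInd, x, hu, h1, h2]
    simp only [e, Finset.sum_add_distrib, Finset.sum_sub_distrib, hx1, hu, if_false,
      Finset.sum_const, Finset.card_powersetCard, Finset.card_univ, Fintype.card_fin,
      nsmul_eq_mul, mul_one]
    nlinarith

/-- The probability that a packet is cached by exactly the users in `S`, for cached fraction `p`. -/
def exactProb (n : ℕ) (p : ℝ) (S : Finset (Fin n)) : ℝ := p ^ S.card * (1 - p) ^ (n - S.card)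

theorem prod_ite_eq_exactProb {n : ℕ} (p : ℝ) (S : Finset (Fin n)) :
    ∏ u, (if u ∈ S then p else 1 - p) = exactProb n p S := by
  rw [Finset.prod_ite, Finset.prod_const, Finset.prod_const, exactProb,
    Finset.filter_mem_eq_inter, Finset.univ_inter]
  have : (Finset.univ.filter fun u => u ∉ S) = Sᶜ := by ext; simp
  rw [this, Finset.card_compl, Fintype.card_fin]

theorem exactProb_nonneg {n : ℕ} {p : ℝ} (h0 : 0 ≤ p) (h1 : p ≤ 1) (S : Finset (Fin n)) :
    0 ≤ exactProb n p S :=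
  mul_nonneg (pow_nonneg h0 _) (pow_nonneg (by linarith) _)

theorem exactProb_le_one {n : ℕ} {p : ℝ} (h0 : 0 ≤ p) (h1 : p ≤ 1) (S : Finset (Fin n)) :
    exactProb n p S ≤ 1 :=
  mul_le_one₀ (pow_le_one₀ h0 h1) (pow_nonneg (by linarith) _)
    (pow_le_one₀ (by linarith) (by linarith))

/-- Variance bound for the number of packets cached by exactly the users in `S`. -/
theorem sum_sq_card_exactlyCached_le {n m B k : ℕ} (hk : k ≤ B) (hB : 1 ≤ B) (f : Fin m)
    (S : Finset (Fin n)) :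
    ∑ C ∈ placementsOfCard n m B k,
      (((exactlyCached C f S).card : ℝ) - B * exactProb n (k / B) S) ^ 2 ≤
      B * (placementsOfCard n m B k).card := by
  classical
  have hB0 : (0 : ℝ) < B := by exact_mod_cast hB
  set N : ℝ := ((placementsOfCard n m B k).card : ℝ) with hN
  set π := exactProb n ((k : ℝ) / B) S with hπ
  have hp0 : 0 ≤ (k : ℝ) / B := by positivity
  have hp1 : (k : ℝ) / B ≤ 1 := by rw [div_le_one hB0]; exact_mod_cast hk
  have hm : 1 ≤ m := Fin.pos f
  have hNprod : N = ∏ _u : Fin n, (B.choose k : ℝ) ^ m := by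
    rw [hN, card_placementsOfCard]
    simp
  let X : Fin B → Placement n m B → ℝ := fun j C => ∏ u, exactInd S j u (C u f)
  have hX1 : ∀ j, ∑ C ∈ placementsOfCard n m B k, X j C = N * π := by
    intro j
    simp only [X]
    rw [sum_placementsOfCard_prod f (exactInd S j), hNprod, hπ, ← prod_ite_eq_exactProb,
      ← Finset.prod_mul_distrib]
    refine Finset.prod_congr rfl fun u _ => ?_
    rw [sum_exactInd]
    obtain ⟨r, rfl⟩ := Nat.exists_eq_add_of_le' hm
    rw [Nat.add_sub_cancel]
    ring
  have hX2 : ∀ i j, i ≠ j → ∑ C ∈ placementsOfCard n m B k, X i C * X j C ≤ N * π ^ 2 := by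
    intro i j hij
    simp only [X, ← Finset.prod_mul_distrib]
    rw [sum_placementsOfCard_prod f (fun u A => exactInd S i u A * exactInd S j u A), hNprod, hπ,
      ← prod_ite_eq_exactProb, ← Finset.prod_pow, ← Finset.prod_mul_distrib]
    refine Finset.prod_le_prod (fun u _ => mul_nonneg (Finset.sum_nonneg fun A _ => ?_)
      (by positivity)) fun u _ => ?_
    · simp only [exactInd]
      split_ifs <;> norm_num
    · refine (mul_le_mul_of_nonneg_right (sum_exactInd_mul_le hk S hij u)
        (by positivity)).trans (le_of_eq ?_)
      obtain ⟨r, rfl⟩ := Nat.exists_eq_add_of_le' hm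
      rw [Nat.add_sub_cancel]
      ring
  have hXX : ∀ j C, X j C * X j C = X j C := by
    intro j C
    simp only [X, ← Finset.prod_mul_distrib]
    refine Finset.prod_congr rfl fun u _ => ?_
    simp only [exactInd]
    split_ifs <;> norm_num
  have hN0 : 0 ≤ N := Nat.cast_nonneg _
  have hπ0 : 0 ≤ π := exactProb_nonneg hp0 hp1 S
  have hπ1 : π ≤ 1 := exactProb_le_one hp0 hp1 S
  -- Diagonal terms contribute `B * π`, off-diagonal ones at most `(B * π) ^ 2`, both times `N`. The
  -- variance is therefore at most `B * π ≤ B`.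
  have hsq : ∑ C ∈ placementsOfCard n m B k, (∑ j, X j C) ^ 2 ≤
      B * (N * π) + B * (B * (N * π ^ 2)) := by
    have e : ∀ C, (∑ j, X j C) ^ 2 = ∑ i, ∑ j, X i C * X j C := fun C => by
      rw [sq, Finset.sum_mul_sum]
    simp only [e]
    rw [Finset.sum_comm]
    have hi : ∀ i ∈ (Finset.univ : Finset (Fin B)),
        ∑ C ∈ placementsOfCard n m B k, ∑ j, X i C * X j C ≤ N * π + B * (N * π ^ 2) := by
      intro i _
      rw [Finset.sum_comm, ← Finset.add_sum_erase _ _ (Finset.mem_univ i)]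
      refine add_le_add ?_ ?_
      · simp only [hXX]
        exact (hX1 i).le
      · refine (Finset.sum_le_sum (g := fun _ => N * π ^ 2) fun j hj =>
          hX2 i j (Finset.ne_of_mem_erase hj).symm).trans ?_
        rw [Finset.sum_const, nsmul_eq_mul]
        refine mul_le_mul_of_nonneg_right ?_ (by positivity)
        have := Finset.card_le_univ (Finset.univ.erase i)
        rw [Fintype.card_fin] at this
        exact_mod_cast this
    refine (Finset.sum_le_sum hi).trans (le_of_eq ?_)
    rw [Finset.sum_const, Finset.card_univ, Fintype.card_fin, nsmul_eq_mul]
    ring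
  have e : ∀ C, (((exactlyCached C f S).card : ℝ) - B * π) ^ 2 =
      (∑ j, X j C) ^ 2 - 2 * (B * π) * (∑ j, X j C) + (B * π) ^ 2 := by
    intro C
    rw [card_exactlyCached_eq_sum]
    ring
  simp only [e, Finset.sum_add_distrib, Finset.sum_sub_distrib, ← Finset.mul_sum,
    Finset.sum_const, nsmul_eq_mul]
  rw [Finset.sum_comm, Finset.sum_congr rfl fun j _ => hX1 j, Finset.sum_const, Finset.card_univ,
    Fintype.card_fin, nsmul_eq_mul, ← hN]
  have h5 : (B : ℝ) * (N * π) ≤ B * N := by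
    refine mul_le_mul_of_nonneg_left ?_ hB0.le
    nlinarith
  nlinarith

open scoped Classical in
/-- Chebyshev's inequality for the exact caching patterns. -/
theorem card_filter_exactlyCached_le {n m B k : ℕ} (hk : k ≤ B) (hB : 1 ≤ B) (f : Fin m)
    (S : Finset (Fin n)) {δ : ℝ} (hδ : 0 < δ) :
    (((placementsOfCard n m B k).filter fun C =>
      (exactProb n (k / B) S + δ) * B < (exactlyCached C f S).card).card : ℝ) ≤
      (placementsOfCard n m B k).card / (δ ^ 2 * B) := by
  have hB0 : (0 : ℝ) < B := by exact_mod_cast hB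
  have h := sum_sq_card_exactlyCached_le hk hB f S
  rw [le_div_iff₀ (by positivity)]
  set T := (placementsOfCard n m B k).filter fun C =>
      (exactProb n (k / B) S + δ) * B < (exactlyCached C f S).card with hT
  have hTsub : T ⊆ placementsOfCard n m B k := Finset.filter_subset _ _
  have h2 : (T.card : ℝ) * (δ * B) ^ 2 ≤ B * (placementsOfCard n m B k).card := by
    refine le_trans ?_ h
    refine le_trans ?_ (Finset.sum_le_sum_of_subset_of_nonneg hTsub fun C _ _ => sq_nonneg _)
    rw [← nsmul_eq_mul, ← Finset.sum_const]
    refine Finset.sum_le_sum fun C hC => ?_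
    have := (Finset.mem_filter.1 hC).2
    refine pow_le_pow_left₀ (by positivity) ?_ 2
    linarith
  refine le_of_mul_le_mul_left (le_trans (le_of_eq ?_) h2) hB0
  ring

/-! ### Upper bound with high probability -/

theorem rapPlacements_uniformPlacement (n m B : ℕ) (M : ℝ) :
    rapPlacements n m B M (uniformPlacement m) = placementsOfCard n m B ⌊M / m * B⌋₊ := by
  ext C
  simp [rapPlacements, placementsOfCard, uniformPlacement, Fintype.mem_piFinset,
    Finset.mem_powersetCard, div_eq_inv_mul]

theorem floor_div_mul_le {m : ℕ} {M : ℝ} (hM : 0 < M) (hMm : M ≤ m) (B : ℕ) :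
    ⌊M / m * B⌋₊ ≤ B := by
  have hm0 : (0 : ℝ) < m := hM.trans_le hMm
  refine Nat.floor_le_of_le ?_
  have : M / m ≤ 1 := by rwa [div_le_one hm0]
  nlinarith [(Nat.cast_nonneg B : (0 : ℝ) ≤ B)]

theorem card_rapPlacements_pos (n : ℕ) {m : ℕ} {M : ℝ} (hM : 0 < M) (hMm : M ≤ m) (B : ℕ) :
    0 < (rapPlacements n m B M (uniformPlacement m)).card := by
  rw [rapPlacements_uniformPlacement, card_placementsOfCard]
  exact pow_pos (pow_pos (Nat.choose_pos (floor_div_mul_le hM hMm B)) _) _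

section Prob

variable {n m B : ℕ} {M : ℝ} {p : Fin m → ℝ} {E E' : Placement n m B → Prop}

theorem rapProb_le_one : rapProb n m B M p E ≤ 1 := by
  classical
  exact div_le_one_of_le₀ (by exact_mod_cast Finset.card_filter_le _ _) (Nat.cast_nonneg _)

theorem rapProb_mono (h : ∀ C ∈ rapPlacements n m B M p, E C → E' C) :
    rapProb n m B M p E ≤ rapProb n m B M p E' := by
  classical
  refine div_le_div_of_nonneg_right ?_ (Nat.cast_nonneg _)
  refine Nat.cast_le.2 (Finset.card_le_card fun C hC => ?_)
  obtain ⟨h1, h2⟩ := Finset.mem_filter.1 hC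
  exact Finset.mem_filter.2 ⟨h1, h C h1 h2⟩

theorem exists_of_rapProb_pos (h : 0 < rapProb n m B M p E) :
    ∃ C ∈ rapPlacements n m B M p, E C := by
  classical
  by_contra! hno
  refine h.ne' ?_
  rw [rapProb, Finset.filter_eq_empty_iff.2 hno]
  simp

end Prob

/-- With high probability, no caching pattern is much more frequent than expected. -/
theorem le_rapProb_card_exactlyCached {n m B : ℕ} {M δ : ℝ} (hM : 0 < M) (hMm : M ≤ m)
    (hB : 1 ≤ B) (hδ : 0 < δ) :
    1 - m * 2 ^ n / (δ ^ 2 * B) ≤ rapProb n m B M (uniformPlacement m) fun C =>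
      ∀ f S, ((exactlyCached C f S).card : ℝ) ≤
        (exactProb n ((⌊M / m * B⌋₊ : ℝ) / B) S + δ) * B := by
  classical
  have hpos := card_rapPlacements_pos n hM hMm B
  have hk := floor_div_mul_le hM hMm B
  rw [rapProb]
  rw [rapPlacements_uniformPlacement] at hpos ⊢
  set k := ⌊M / m * B⌋₊
  set Q := placementsOfCard n m B k with hQ
  have hpos' : (0 : ℝ) < Q.card := by exact_mod_cast hpos
  have hB0 : (0 : ℝ) < B := by exact_mod_cast hB
  rw [le_div_iff₀ hpos']
  let bad : Fin m × Finset (Fin n) → Finset (Placement n m B) := fun x =>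
    Q.filter fun C => (exactProb n (k / B) x.2 + δ) * B < (exactlyCached C x.1 x.2).card
  have hbad : ((Finset.univ.biUnion bad).card : ℝ) ≤ m * 2 ^ n * (Q.card / (δ ^ 2 * B)) := by
    have h1 : ((Finset.univ.biUnion bad).card : ℝ) ≤ ∑ x, ((bad x).card : ℝ) := by
      exact_mod_cast Finset.card_biUnion_le
    refine h1.trans ((Finset.sum_le_sum fun x _ =>
      card_filter_exactlyCached_le hk hB x.1 x.2 hδ).trans (le_of_eq ?_))
    simp [hQ]
  have hcover : Q ⊆ (Q.filter fun C => ∀ f S, ((exactlyCached C f S).card : ℝ) ≤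
      (exactProb n ((k : ℝ) / B) S + δ) * B) ∪ Finset.univ.biUnion bad := by
    intro C hC
    by_cases hg : ∀ f S, ((exactlyCached C f S).card : ℝ) ≤
        (exactProb n ((k : ℝ) / B) S + δ) * B
    · exact Finset.mem_union_left _ (Finset.mem_filter.2 ⟨hC, hg⟩)
    · push Not at hg
      obtain ⟨f, S, hfS⟩ := hg
      exact Finset.mem_union_right _ (Finset.mem_biUnion.2
        ⟨(f, S), Finset.mem_univ _, Finset.mem_filter.2 ⟨hC, hfS⟩⟩)
  have h2 : (Q.card : ℝ) ≤ (Q.filter fun C => ∀ f S, ((exactlyCached C f S).card : ℝ) ≤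
      (exactProb n ((k : ℝ) / B) S + δ) * B).card + (Finset.univ.biUnion bad).card := by
    exact_mod_cast (Finset.card_le_card hcover).trans (Finset.card_union_le _ _)
  have e : (1 - m * 2 ^ n / (δ ^ 2 * B)) * (Q.card : ℝ) =
      Q.card - m * 2 ^ n * (Q.card / (δ ^ 2 * B)) := by
    field_simp
  rw [e]
  refine (sub_le_iff_le_add.2 (h2.trans (add_le_add le_rfl hbad))).trans (le_of_eq ?_)
  congr!

theorem tendsto_floor_mul_div (p : ℝ) (hp : 0 ≤ p) :
    Tendsto (fun B : ℕ => (⌊p * B⌋₊ : ℝ) / B) atTop (𝓝 p) :=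
  (tendsto_nat_floor_mul_div_atTop hp).comp tendsto_natCast_atTop_atTop

/-- The cached fraction `⌊M / m * B⌋ / B` only tends to `M / m`: half of `δ` absorbs this by
continuity, the other half goes to Chebyshev's inequality. -/
theorem tendsto_rapProb_card_exactlyCached (n : ℕ) {m : ℕ} {M δ : ℝ} (hM : 0 < M) (hMm : M ≤ m)
    (hδ : 0 < δ) :
    Tendsto (fun B : ℕ => rapProb n m B M (uniformPlacement m) fun C =>
      ∀ f S, ((exactlyCached C f S).card : ℝ) ≤ (exactProb n (M / m) S + δ) * B)
      atTop (𝓝 1) := by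
  have hlow : Tendsto (fun B : ℕ => 1 - (m : ℝ) * 2 ^ n / ((δ / 2) ^ 2 * B)) atTop (𝓝 (1 - 0)) := by
    refine tendsto_const_nhds.sub ?_
    simp only [← div_div]
    exact tendsto_const_div_atTop_nhds_zero_nat _
  rw [sub_zero] at hlow
  have hp : 0 ≤ M / m := by positivity
  have hcont : ∀ᶠ B : ℕ in atTop, ∀ S : Finset (Fin n),
      exactProb n ((⌊M / m * B⌋₊ : ℝ) / B) S < exactProb n (M / m) S + δ / 2 := by
    refine eventually_all.2 fun S => ?_
    have hc : Continuous fun p => exactProb n p S := by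
      unfold exactProb
      fun_prop
    exact ((hc.tendsto _).comp (tendsto_floor_mul_div _ hp)).eventually_lt_const (by linarith)
  refine tendsto_of_tendsto_of_tendsto_of_le_of_le' hlow tendsto_const_nhds ?_
    (Eventually.of_forall fun B => rapProb_le_one)
  filter_upwards [hcont, eventually_ge_atTop 1] with B hBc hB1
  refine (le_rapProb_card_exactlyCached hM hMm hB1 (half_pos hδ)).trans
    (rapProb_mono fun C _ hC f S => (hC f S).trans ?_)
  refine mul_le_mul_of_nonneg_right ?_ (Nat.cast_nonneg _)
  linarith [hBc S]

/-- The upper bound on the rate of UP-GCLC, with high probability over the placement. -/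
theorem GreedyRule.tendsto_rapProb_gclcRate_le (g : GreedyRule) (n : ℕ) {m : ℕ} (L : ℕ) {M ε : ℝ}
    (hM : 0 < M) (hMm : M ≤ m) (hε : 0 < ε) :
    Tendsto (fun B : ℕ => rapProb n m B M (uniformPlacement m) fun C =>
      g.gclcRate L (zipf 0 m) C ≤
        min ((L : ℝ) * ((m : ℝ) / M - 1)) (min ((L : ℝ) * n) ((m : ℝ) - M)) + ε)
      atTop (𝓝 1) := by
  have hm0 : (0 : ℝ) < m := hM.trans_le hMm
  have hm : 1 ≤ m := by exact_mod_cast hm0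
  -- The excess `δ` accumulates over `2 ^ n` labels and `L` requests; `L + 1` keeps the denominator
  -- positive when `L = 0`.
  set δ := ε / ((L + 1) * 2 ^ n) with hδ
  have hδ0 : 0 < δ := by positivity
  refine tendsto_of_tendsto_of_tendsto_of_le_of_le'
    (tendsto_rapProb_card_exactlyCached n hM hMm hδ0) tendsto_const_nhds ?_
    (Eventually.of_forall fun B => rapProb_le_one)
  -- Rounding costs less than one cached packet per file, thus at most `m` extra transmissions under
  -- the packet coloring.
  have hlarge : ∀ᶠ B : ℕ in atTop, (m : ℝ) ≤ ε * B := by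
    filter_upwards [eventually_ge_atTop ⌈(m : ℝ) / ε⌉₊] with B hB
    have := (Nat.le_ceil _).trans (Nat.cast_le (α := ℝ).2 hB)
    rw [div_le_iff₀ hε] at this
    linarith
  filter_upwards [hlarge, eventually_ge_atTop 1] with B hBε hB1
  have hB0 : (0 : ℝ) < B := by exact_mod_cast hB1
  refine rapProb_mono fun C hCP hC => ?_
  rw [rapPlacements_uniformPlacement] at hCP
  have hcard : ∀ u f, (C u f).card = ⌊M / m * B⌋₊ := fun u f =>
    (Finset.mem_powersetCard.1 (Fintype.mem_piFinset.1 (Fintype.mem_piFinset.1 hCP u) f)).2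
  have hk := floor_div_mul_le hM hMm B
  rw [GreedyRule.gclcRate, div_le_iff₀ hB0]
  rw [← min_add_add_right, ← min_add_add_right, min_mul_of_nonneg _ _ hB0.le,
    min_mul_of_nonneg _ _ hB0.le]
  refine demandExp_zipf_zero_le hm fun d => le_min ?_ (le_min ?_ ?_)
  · refine (g.transmissions_le_of_card_le C d (div_pos hM hm0) (by rwa [div_le_one hm0]) hδ0.le
      hC).trans (mul_le_mul_of_nonneg_right ?_ hB0.le)
    have h1 : (1 - M / m) / (M / m) = m / M - 1 := by
      field_simp
    have h2 : (L : ℝ) * (2 ^ n * δ) ≤ ε := by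
      rw [hδ, mul_div_assoc', mul_div_assoc', div_le_iff₀ (by positivity)]
      have : 0 < (2 : ℝ) ^ n := by positivity
      nlinarith
    rw [h1, mul_add]
    linarith
  · have h1 : (g.transmissions C d : ℝ) ≤ L * n * B := by exact_mod_cast g.transmissions_le_mul C d
    nlinarith
  · have h1 := (g.transmissions_le_packet C d).trans (localColors_packetColoring_le C d hcard)
    have h2 : (g.transmissions C d : ℝ) ≤ m * (B - ⌊M / m * B⌋₊) := by
      rw [← Nat.cast_sub hk]
      exact_mod_cast h1
    have h3 := Nat.lt_floor_add_one (M / m * B)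
    have h4 : (m : ℝ) * (M / m * B) = M * B := by field_simp
    nlinarith

theorem GreedyRule.gclcRate_nonneg (g : GreedyRule) {n m B : ℕ} (L : ℕ) (C : Placement n m B) :
    0 ≤ g.gclcRate L (zipf 0 m) C :=
  div_nonneg (demandExp_zipf_zero_nonneg fun _ => Nat.cast_nonneg _) (Nat.cast_nonneg _)

theorem GreedyRule.bddBelow_rapGclcRate (g : GreedyRule) (n m L : ℕ) (M : ℝ) :
    BddBelow {r : ℝ | Tendsto (fun B : ℕ => rapProb n m B M (uniformPlacement m) fun C =>
      g.gclcRate L (zipf 0 m) C ≤ r) atTop (𝓝 1)} := by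
  refine ⟨0, fun r hr => ?_⟩
  obtain ⟨B, hB⟩ := ((hr : Tendsto _ _ _).eventually_const_lt one_pos).exists
  obtain ⟨C, -, hC⟩ := exists_of_rapProb_pos hB
  exact (g.gclcRate_nonneg L C).trans hC

theorem GreedyRule.rapGclcRate_le (g : GreedyRule) (n : ℕ) {m : ℕ} (L : ℕ) {M : ℝ}
    (hM : 0 < M) (hMm : M ≤ m) :
    g.rapGclcRate n m L M (zipf 0 m) (uniformPlacement m) ≤
      min ((L : ℝ) * ((m : ℝ) / M - 1)) (min ((L : ℝ) * n) ((m : ℝ) - M)) :=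
  le_of_forall_pos_le_add fun _ hε =>
    csInf_le (g.bddBelow_rapGclcRate n m L M) (g.tendsto_rapProb_gclcRate_le n L hM hMm hε)

/-- Placements whose rate is close to the limit superior in probability exist. -/
theorem GreedyRule.exists_gclcRate_le (g : GreedyRule) (n : ℕ) {m : ℕ} (L : ℕ) {M ε : ℝ}
    (hM : 0 < M) (hMm : M ≤ m) (hε : 0 < ε) :
    ∃ B : ℕ, 1 ≤ B ∧ ∃ C ∈ rapPlacements n m B M (uniformPlacement m),
      g.gclcRate L (zipf 0 m) C ≤
        g.rapGclcRate n m L M (zipf 0 m) (uniformPlacement m) + ε := by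
  obtain ⟨r, hr, hrε⟩ := exists_lt_of_csInf_lt
    ⟨_, g.tendsto_rapProb_gclcRate_le n L hM hMm one_pos⟩
    (lt_add_of_pos_right (g.rapGclcRate n m L M (zipf 0 m) (uniformPlacement m)) hε)
  obtain ⟨B, hB, hB1⟩ :=
    (((hr : Tendsto _ _ _).eventually_const_lt one_pos).and (eventually_ge_atTop 1)).exists
  obtain ⟨C, hCP, hC⟩ := exists_of_rapProb_pos hB
  exact ⟨B, hB1, C, hCP, hC.trans hrε.le⟩

/-! ### Generic coding matrices -/

/-- All combinations of the columns of `A` with coefficients in `ZMod 2` that are not forced to be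
dependent are independent. -/
def IsGenericMatrix {r : ℕ} {ι K : Type*} [Fintype ι] [Field K] [Algebra (ZMod 2) K]
    (A : Matrix (Fin r) ι K) : Prop :=
  ∀ D : Matrix ι (Fin r) (ZMod 2), (∃ A₀ : Matrix (Fin r) ι (ZMod 2), A₀ * D = 1) →
    (A * D.map (algebraMap (ZMod 2) K)).det ≠ 0

/-- With indeterminate entries, each determinant is a nonzero polynomial because it equals 1 at
`A₀`. There are finitely many `D`, so the product of these polynomials is nonzero, and it has a
nonvanishing point over any field with more elements than its total degree. -/
theorem exists_isGenericMatrix (r : ℕ) (ι : Type*) [Fintype ι] :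
    ∃ q : ℕ, ∀ (K : Type) [Field K] [Algebra (ZMod 2) K], q ≤ Nat.card K →
      ∃ A : Matrix (Fin r) ι K, IsGenericMatrix A := by
  classical
  let X : Matrix (Fin r) ι (MvPolynomial (Fin r × ι) (ZMod 2)) :=
    Matrix.of fun i j => MvPolynomial.X (i, j)
  let Y (D : Matrix ι (Fin r) (ZMod 2)) : Matrix ι (Fin r) (MvPolynomial (Fin r × ι) (ZMod 2)) :=
    D.map MvPolynomial.C
  let good : Finset (Matrix ι (Fin r) (ZMod 2)) :=
    Finset.univ.filter fun D => ∃ A₀ : Matrix (Fin r) ι (ZMod 2), A₀ * D = 1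
  let Q : Matrix ι (Fin r) (ZMod 2) → MvPolynomial (Fin r × ι) (ZMod 2) := fun D =>
    (X * Y D).det
  have hQ : ∀ (K : Type) [Field K] [Algebra (ZMod 2) K] (x : Fin r × ι → K)
      (D : Matrix ι (Fin r) (ZMod 2)), MvPolynomial.aeval x (Q D) =
        ((Matrix.of fun i j => x (i, j) : Matrix (Fin r) ι K) *
          (D.map (algebraMap (ZMod 2) K) : Matrix ι (Fin r) K)).det := by
    intro K _ _ x D
    rw [AlgHom.map_det]
    congr 1
    ext i j
    rw [AlgHom.mapMatrix_apply, Matrix.map_apply, Matrix.mul_apply, Matrix.mul_apply, map_sum]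
    simp [X, Y]
  have hP : ∏ D ∈ good, Q D ≠ 0 := by
    refine Finset.prod_ne_zero_iff.2 fun D hD h0 => ?_
    obtain ⟨A₀, hA₀⟩ := (Finset.mem_filter.1 hD).2
    have h := hQ (ZMod 2) (fun p => A₀ p.1 p.2) D
    rw [h0, map_zero] at h
    have e : (Matrix.of fun i j => A₀ i j : Matrix (Fin r) ι (ZMod 2)) *
        (D.map (algebraMap (ZMod 2) (ZMod 2)) : Matrix ι (Fin r) (ZMod 2)) = 1 := by
      rw [← hA₀]
      congr 1
    rw [e, Matrix.det_one] at h
    exact zero_ne_one h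
  set P := ∏ D ∈ good, Q D with hPdef
  refine ⟨P.totalDegree + 1, fun K _ _ hK => ?_⟩
  have : Finite K := Nat.finite_of_card_ne_zero (by omega)
  have := Fintype.ofFinite K
  rw [Nat.card_eq_fintype_card] at hK
  have hPK : MvPolynomial.map (algebraMap (ZMod 2) K) P ≠ 0 :=
    (map_ne_zero_iff _ (MvPolynomial.map_injective _ (algebraMap (ZMod 2) K).injective)).2 hP
  have hex : ∃ x : Fin r × ι → K,
      MvPolynomial.eval x (MvPolynomial.map (algebraMap (ZMod 2) K) P) ≠ 0 := by
    by_contra! hno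
    refine hPK (MvPolynomial.eq_zero_of_eval_zero_at_prod_finset _ (fun _ => Finset.univ)
      (fun i => ?_) fun x _ => hno x)
    have h1 : (MvPolynomial.map (algebraMap (ZMod 2) K) P).degreeOf i ≤ P.degreeOf i := by
      rw [MvPolynomial.degreeOf_def, MvPolynomial.degreeOf_def]
      exact Multiset.count_le_of_le i MvPolynomial.degrees_map_le
    have h2 := MvPolynomial.degreeOf_le_totalDegree P i
    rw [Finset.card_univ]
    omega
  obtain ⟨x, hx⟩ := hex
  rw [MvPolynomial.eval_map, ← MvPolynomial.aeval_def, hPdef, map_prod,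
    Finset.prod_ne_zero_iff] at hx
  refine ⟨Matrix.of fun i j => x (i, j), fun D hD => ?_⟩
  rw [← hQ]
  exact hx D (Finset.mem_filter.2 ⟨Finset.mem_univ _, hD⟩)

/-- In the kernel of a generic matrix, `r` coordinates vanish even if further coordinates may agree
with one of them. -/
theorem IsGenericMatrix.eq_zero_of_mulVec_eq_zero {r : ℕ} {ι K : Type*} [Fintype ι] [DecidableEq ι]
    [Field K] [Algebra (ZMod 2) K] {A : Matrix (Fin r) ι K} (hA : IsGenericMatrix A)
    {N : Finset ι} (hN : N.card = r) {i₀ : ι} (hi₀ : i₀ ∈ N) {bad : Finset ι}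
    {y : ι → K} (hy : ∀ i ∉ N, y i = if i ∈ bad then y i₀ else 0)
    (hAy : A.mulVec y = 0) : ∀ i ∈ N, y i = 0 := by
  let e : Fin r ≃ N := (finCongr hN.symm).trans N.equivFin.symm
  -- `D` rebuilds `y` from its coordinates in `N`: the unit vectors of `N`, where that of `i₀` also
  -- carries the indicator of the coordinates in `bad` outside `N`. Restriction to `N` is a left
  -- inverse.
  let D : Matrix ι (Fin r) (ZMod 2) := Matrix.of fun i j =>
    if i ∈ N then (if i = e j then 1 else 0) else if i ∈ bad ∧ i₀ = e j then 1 else 0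
  let A₀ : Matrix (Fin r) ι (ZMod 2) := Matrix.of fun j i => if i = e j then 1 else 0
  have hD : A₀ * D = 1 := by
    ext j j'
    rw [Matrix.mul_apply, Finset.sum_eq_single (e j : ι)]
    · simp [A₀, D, Matrix.one_apply]
    · intro i _ hi
      simp [A₀, hi]
    · simp
  have hdet := hA D ⟨A₀, hD⟩
  have hDz : (D.map (algebraMap (ZMod 2) K)).mulVec (fun j => y (e j)) = y := by
    funext i
    rw [Matrix.mulVec, dotProduct]
    by_cases hi : i ∈ N
    · rw [Finset.sum_eq_single (e.symm ⟨i, hi⟩)]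
      · simp [D, hi]
      · intro j _ hj
        have : i ≠ e j := by
          rintro rfl
          simp at hj
        simp [D, hi, this]
      · simp
    · rw [Finset.sum_eq_single (e.symm ⟨i₀, hi₀⟩)]
      · rw [hy i hi]
        by_cases hb : i ∈ bad <;> simp [D, hi, hb]
      · intro j _ hj
        have : i₀ ≠ e j := by
          intro h
          refine hj ?_
          rw [Equiv.eq_symm_apply]
          exact Subtype.ext h.symm
        simp [D, hi, this]
      · simp
  rw [← hDz, Matrix.mulVec_mulVec] at hAy
  have hz := Matrix.eq_zero_of_mulVec_eq_zero hdet hAy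
  intro i hi
  have := congrFun hz (e.symm ⟨i, hi⟩)
  simpa using this

/-- The special case without repeated coordinates, `bad = ∅`. -/
theorem IsGenericMatrix.isMDSGenerator {r : ℕ} {ι K : Type*} [Fintype ι] [Field K]
    [Algebra (ZMod 2) K] {A : Matrix (Fin r) ι K} (hA : IsGenericMatrix A) :
    IsMDSGenerator A := by
  classical
  intro s hs
  refine Fintype.linearIndependent_iff.2 fun g hg i => ?_
  let y : ι → K := fun j => if h : j ∈ s then g ⟨j, h⟩ else 0
  have hAy : A.mulVec y = 0 := by
    funext t
    have h1 := congrFun hg t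
    simp only [Finset.sum_apply, Pi.smul_apply, smul_eq_mul, Pi.zero_apply] at h1
    rw [Pi.zero_apply, ← h1, Matrix.mulVec, dotProduct,
      ← Finset.sum_subset (Finset.subset_univ s) (fun j _ hj => by simp [y, hj]),
      ← Finset.sum_coe_sort]
    exact Finset.sum_congr rfl fun j _ => by simp [y, mul_comm]
  have := hA.eq_zero_of_mulVec_eq_zero hs i.2 (bad := ∅)
    (fun j hj => by simp [y, hj]) hAy i i.2
  simpa [y] using this

/-! ### Decoding and the scheme for a fixed placement -/

/-- A caching function and an encoder that determine the requested files give a scheme. -/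
theorem exists_zeroError {n m L : ℕ} {M : ℝ} {F : ℕ}
    (cache : Fin n → Library m F → (Fin ⌊M * F⌋₊ → ZMod 2))
    (encode : Library m F → Demand n m L → List (ZMod 2))
    (h : ∀ W W' d u, encode W d = encode W' d → cache u W = cache u W' →
      ∀ l, W (d u l) = W' (d u l)) :
    ∃ S : CachingScheme n m L M F, S.cache = cache ∧ S.encode = encode ∧ S.ZeroError := by
  classical
  refine ⟨⟨cache, encode, fun u x c d =>
    if hW : ∃ W, encode W d = x ∧ cache u W = c then fun l => hW.choose (d u l) else 0⟩,
    rfl, rfl, fun W d u => ?_⟩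
  have hW : ∃ W', encode W' d = encode W d ∧ cache u W' = cache u W := ⟨W, rfl, rfl⟩
  simp only [dif_pos hW]
  funext l
  exact h _ _ d u hW.choose_spec.1 hW.choose_spec.2 l

section Symbols

variable {m B k : ℕ} (e : GaloisField 2 k ≃ₗ[ZMod 2] (Fin k → ZMod 2))

theorem apply_packetSymbol (W : Library m (B * k)) (p : Packet m B) (i : Fin k) :
    e (packetSymbol e W p) i = W p.1 (finProdFinEquiv (p.2, i)) := by
  simp [packetSymbol]

theorem eq_of_packetSymbol_eq {W W' : Library m (B * k)} {f : Fin m}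
    (h : ∀ j, packetSymbol e W (f, j) = packetSymbol e W' (f, j)) : W f = W' f := by
  funext i
  obtain ⟨⟨j, t⟩, rfl⟩ := finProdFinEquiv.surjective i
  rw [← apply_packetSymbol e W (f, j) t, h j, apply_packetSymbol]

theorem length_symbolBits {r : ℕ} (y : Fin r → GaloisField 2 k) :
    (symbolBits e y).length = r * k := by
  simp [symbolBits]

theorem symbolBits_injective {r : ℕ} :
    Function.Injective (symbolBits e : (Fin r → GaloisField 2 k) → List (ZMod 2)) := by
  intro y y' h
  have h1 := List.ofFn_injective h
  funext i
  refine e.injective (funext fun t => ?_)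
  have := congrFun h1 (finProdFinEquiv (i, t))
  simpa using this

end Symbols

section Decoding

variable {n m L B : ℕ} {C : Placement n m B}

theorem IsGreedyColoring.indep {U : Finset (Vertex n m B)} {P : Finset (Finset (Vertex n m B))}
    (h : IsGreedyColoring C U P) :
    ∀ I ∈ P, ∀ v ∈ I, ∀ w ∈ I, ¬ (conflictGraph C).Adj v w := by
  induction h with
  | nil => simp
  | step U I P v _ _ _ hindep _ _ ih =>
    intro J hJ
    rcases Finset.mem_insert.1 hJ with rfl | hJ
    · exact hindep
    · exact ih J hJ

theorem IsGreedyColoring.cover {U : Finset (Vertex n m B)} {P : Finset (Finset (Vertex n m B))}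
    (h : IsGreedyColoring C U P) : ∀ v ∈ U, ∃ I ∈ P, v ∈ I := by
  induction h with
  | nil => simp
  | step U I P v _ _ _ _ _ _ ih =>
    intro w hw
    by_cases hwI : w ∈ I
    · exact ⟨I, Finset.mem_insert_self _ _, hwI⟩
    · obtain ⟨J, hJ, hwJ⟩ := ih w (Finset.mem_sdiff.2 ⟨hw, hwI⟩)
      exact ⟨J, Finset.mem_insert_of_mem hJ, hwJ⟩

theorem GreedyRule.gclc_indep (g : GreedyRule) (C : Placement n m B) (d : Demand n m L) :
    ∀ I ∈ g.gclc C d, ∀ v ∈ I, ∀ w ∈ I, ¬ (conflictGraph C).Adj v w := by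
  rw [gclc]
  split_ifs
  · exact (g.isGreedy C d).indep
  · intro I hI v hv w hw hadj
    obtain ⟨x, -, rfl⟩ := Finset.mem_image.1 hI
    exact hadj.2 ((Finset.mem_filter.1 hw).2.trans (Finset.mem_filter.1 hv).2.symm)

theorem GreedyRule.gclc_cover (g : GreedyRule) (C : Placement n m B) (d : Demand n m L) :
    ∀ v ∈ vertices C d, ∃ I ∈ g.gclc C d, v ∈ I := by
  rw [gclc]
  split_ifs
  · exact (g.isGreedy C d).cover
  · intro v hv
    exact ⟨_, Finset.mem_image_of_mem _ hv, Finset.mem_filter.2 ⟨hv, rfl⟩⟩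

/-- Decoding: a user that knows its cached packets and the combinations of the color sums with the
columns of a generic matrix knows the packets it needs. Here `Δ` is the difference of two libraries
that look the same to the user. -/
theorem eq_zero_of_mulVec_color_sums {K : Type*} [Field K] [Algebra (ZMod 2) K] {d : Demand n m L}
    {P : Finset (Finset (Vertex n m B))}
    (hindep : ∀ I ∈ P, ∀ v ∈ I, ∀ w ∈ I, ¬ (conflictGraph C).Adj v w)
    (hcover : ∀ v ∈ vertices C d, ∃ I ∈ P, v ∈ I)
    {A : Matrix (Fin (localColors C d P)) P K} (hA : IsGenericMatrix A) (Δ : Packet m B → K)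
    (u : Fin n) (hcache : ∀ p, Cached C u p → Δ p = 0)
    (hsum : A.mulVec (fun I => ∑ p ∈ (I : Finset (Vertex n m B)).image Prod.snd, Δ p) = 0)
    (l : Fin L) (j : Fin B) : Δ (d u l, j) = 0 := by
  classical
  by_cases hc : Cached C u (d u l, j)
  · exact hcache _ hc
  set p : Packet m B := (d u l, j) with hp
  have hv : ((u, p) : Vertex n m B) ∈ vertices C d :=
    Finset.mem_filter.2 ⟨Finset.mem_univ _, ⟨l, rfl⟩, hc⟩
  set y : P → K := fun I => ∑ p ∈ (I : Finset (Vertex n m B)).image Prod.snd, Δ p with hy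
  -- In a color without interference for `(u, p)`, every packet other than `p` is cached by `u` and
  -- drops out.
  have hyI : ∀ I : P, (∀ w ∈ (I : Finset (Vertex n m B)), ¬ (conflictGraph C).Adj (u, p) w) →
      y I = if p ∈ (I : Finset (Vertex n m B)).image Prod.snd then Δ p else 0 := by
    intro I hI
    have hz : ∀ p' ∈ (I : Finset (Vertex n m B)).image Prod.snd, p' ≠ p → Δ p' = 0 := by
      intro p' hp' hne
      obtain ⟨w, hw, rfl⟩ := Finset.mem_image.1 hp'
      by_contra h0
      exact hI w hw ⟨fun hcw => h0 (hcache _ hcw), hne⟩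
    split_ifs with hpI
    · exact Finset.sum_eq_single p hz fun h => absurd hpI h
    · exact Finset.sum_eq_zero fun p' hp' => hz p' hp' (by rintro rfl; exact hpI hp')
  obtain ⟨I₀, hI₀, hvI₀⟩ := hcover _ hv
  have hy0 : y ⟨I₀, hI₀⟩ = Δ p := by
    rw [hyI _ fun w hw => hindep I₀ hI₀ _ hvI₀ w hw]
    exact if_pos (Finset.mem_image.2 ⟨_, hvI₀, rfl⟩)
  let Nv : Finset P := Finset.univ.filter fun I =>
    ∃ w ∈ (I : Finset (Vertex n m B)), w = (u, p) ∨ (conflictGraph C).Adj (u, p) w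
  have hNv : Nv.card ≤ localColors C d P := by
    have h1 : Nv.card ≤ (P.filter fun I => ∃ w ∈ I, w = (u, p) ∨
        (conflictGraph C).Adj (u, p) w).card := by
      refine Finset.card_le_card_of_injOn Subtype.val (fun I hI => ?_)
        Subtype.val_injective.injOn
      exact Finset.mem_filter.2 ⟨I.2, (Finset.mem_filter.1 hI).2⟩
    refine h1.trans ?_
    rw [localColors]
    convert Finset.le_sup (f := fun v => (P.filter fun I => ∃ w ∈ I, w = v ∨
        (conflictGraph C).Adj v w).card) hv
  -- The colors in this closed out-neighborhood may be fewer than the local colors; arbitrary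
  -- further colors fill up to the number of rows.
  obtain ⟨N, hNvN, -, hN⟩ := Finset.exists_subsuperset_card_eq (Finset.subset_univ Nv) hNv
    (by rw [Finset.card_univ, Fintype.card_coe]; exact localColors_le_card C d P)
  have hI₀N : (⟨I₀, hI₀⟩ : P) ∈ N :=
    hNvN (Finset.mem_filter.2 ⟨Finset.mem_univ _, _, hvI₀, Or.inl rfl⟩)
  let bad : Finset P := Finset.univ.filter fun I =>
    p ∈ (I : Finset (Vertex n m B)).image Prod.snd
  have h := hA.eq_zero_of_mulVec_eq_zero hN hI₀N (bad := bad) (y := y) (fun I hI => ?_) hsum _ hI₀N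
  · rwa [hy0] at h
  · rw [hy0, hyI I fun w hw hadj =>
      hI (hNvN (Finset.mem_filter.2 ⟨Finset.mem_univ _, w, hw, Or.inr hadj⟩))]
    simp [bad]

end Decoding

/-- The packets assigned to a user fit into its cache: rounding down per file gives `m * ⌊M / m * B⌋
* k ≤ M * B * k`. -/
theorem card_cached_bits_le {n m B k : ℕ} {M : ℝ} (hM : 0 < M) (hMm : M ≤ m) {C : Placement n m B}
    (hC : C ∈ rapPlacements n m B M (uniformPlacement m)) (u : Fin n) :
    Nat.card ({p : Packet m B // Cached C u p} × Fin k) ≤ ⌊M * ((B * k : ℕ) : ℝ)⌋₊ := by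
  classical
  have hm0 : (0 : ℝ) < m := hM.trans_le hMm
  rw [rapPlacements_uniformPlacement] at hC
  have hcard : ∀ f, (C u f).card = ⌊M / m * B⌋₊ := fun f =>
    (Finset.mem_powersetCard.1 (Fintype.mem_piFinset.1 (Fintype.mem_piFinset.1 hC u) f)).2
  have h1 : Nat.card {p : Packet m B // Cached C u p} = m * ⌊M / m * B⌋₊ := by
    let φ : {p : Packet m B // Cached C u p} ≃ (f : Fin m) × (C u f) :=
      { toFun := fun p => ⟨p.1.1, p.1.2, p.2⟩
        invFun := fun x => ⟨(x.1, x.2.1), x.2.2⟩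
        left_inv := fun _ => rfl
        right_inv := fun _ => rfl }
    rw [Nat.card_congr φ, Nat.card_eq_fintype_card, Fintype.card_sigma]
    simp [hcard]
  rw [Nat.card_prod, h1, Nat.card_eq_fintype_card, Fintype.card_fin]
  refine Nat.le_floor ?_
  have h2 : (⌊M / m * B⌋₊ : ℝ) ≤ M / m * B := Nat.floor_le (by positivity)
  push_cast
  calc (m : ℝ) * ⌊M / m * B⌋₊ * k ≤ m * (M / m * B) * k := by gcongr
    _ = M * (B * k) := by field_simp

/-- GCLC, for a fixed placement, is a zero-error caching scheme. -/
theorem GreedyRule.eventually_exists_isGCLC (g : GreedyRule) {n m L B : ℕ} {M : ℝ}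
    (hM : 0 < M) (hMm : M ≤ m) {C : Placement n m B}
    (hC : C ∈ rapPlacements n m B M (uniformPlacement m)) :
    ∀ᶠ k : ℕ in atTop, ∀ e : GaloisField 2 k ≃ₗ[ZMod 2] (Fin k → ZMod 2),
      ∃ S : CachingScheme n m L M (B * k), S.IsGCLC g e C ∧ S.ZeroError ∧
        ∀ W d, (S.encode W d).length = g.transmissions C d * k := by
  classical
  have hgen : ∀ᶠ k : ℕ in atTop, ∀ d : Demand n m L,
      ∃ A : Matrix (Fin (g.transmissions C d)) (g.gclc C d) (GaloisField 2 k),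
        IsGenericMatrix A := by
    refine eventually_all.2 fun d => ?_
    obtain ⟨q, hq⟩ := exists_isGenericMatrix (g.transmissions C d) (g.gclc C d)
    -- The `+ 1` excludes `k = 0`, as required by the cardinality `2 ^ k` of the field.
    filter_upwards [eventually_ge_atTop (q + 1)] with k hk
    refine hq _ ?_
    rw [GaloisField.card 2 k (by omega)]
    exact (Nat.le_of_succ_le hk).trans Nat.lt_two_pow_self.le
  filter_upwards [hgen] with k hk e
  choose A hA using hk
  have hemb : ∀ u, ∃ φ : {p : Packet m B // Cached C u p} × Fin k →
      Fin ⌊M * ((B * k : ℕ) : ℝ)⌋₊, Function.Injective φ := by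
    intro u
    have h := card_cached_bits_le (k := k) hM hMm hC u
    rw [Nat.card_eq_fintype_card] at h
    obtain ⟨φ⟩ := Function.Embedding.nonempty_of_card_le
      (h.trans_eq (Fintype.card_fin _).symm)
    exact ⟨φ, φ.injective⟩
  choose φ hφ using hemb
  let cache : Fin n → Library m (B * k) → (Fin ⌊M * ((B * k : ℕ) : ℝ)⌋₊ → ZMod 2) := fun u W =>
    -- Cache positions that hold no packet bit are filled with zeros, so they reveal nothing
    -- further.
    Function.extend (φ u) (fun x => e (packetSymbol e W x.1.1) x.2) 0
  let encode : Library m (B * k) → Demand n m L → List (ZMod 2) := fun W d =>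
    symbolBits e ((A d).mulVec fun I =>
      ∑ p ∈ (I : Finset (Vertex n m B)).image Prod.snd, packetSymbol e W p)
  have hcache : ∀ u W W', cache u W = cache u W' ↔
      ∀ p : Packet m B, Cached C u p → packetSymbol e W p = packetSymbol e W' p := by
    intro u W W'
    constructor
    · intro h p hp
      refine e.injective (funext fun t => ?_)
      have := congrFun h (φ u (⟨p, hp⟩, t))
      simpa only [cache, (hφ u).extend_apply] using this
    · intro h
      simp only [cache]
      congr 1
      funext x
      rw [h _ x.1.2]
  obtain ⟨S, hSc, hSe, hS0⟩ := exists_zeroError cache encode (by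
    intro W W' d u henc hcac l
    refine eq_of_packetSymbol_eq e fun j => sub_eq_zero.1 ?_
    refine eq_zero_of_mulVec_color_sums (g.gclc_indep C d) (g.gclc_cover C d) (hA d)
      (fun p => packetSymbol e W p - packetSymbol e W' p) u
      (fun p hp => sub_eq_zero.2 ((hcache u W W').1 hcac p hp)) ?_ l j
    have := symbolBits_injective e henc
    rw [← sub_eq_zero, ← Matrix.mulVec_sub] at this
    refine Eq.trans ?_ this
    refine congrArg (A d).mulVec (funext fun I => ?_)
    simp [Finset.sum_sub_distrib])
  refine ⟨S, ⟨fun u W W' => by rw [hSc]; exact hcache u W W', fun d =>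
    ⟨A d, (hA d).isMDSGenerator, fun W => by rw [hSe]⟩⟩, hS0, fun W d => ?_⟩
  rw [hSe]
  exact length_symbolBits e _

theorem CachingScheme.rate_eq_gclcRate {g : GreedyRule} {n m L B k : ℕ} {M : ℝ} (hk : 1 ≤ k)
    {C : Placement n m B} {S : CachingScheme n m L M (B * k)}
    (hS : ∀ W d, (S.encode W d).length = g.transmissions C d * k) :
    S.rate (zipf 0 m) = g.gclcRate L (zipf 0 m) C := by
  have hk0 : (k : ℝ) ≠ 0 := by positivity
  simp only [CachingScheme.rate, hS, Nat.cast_mul, demandExp_mul_const, GreedyRule.gclcRate,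
    ciSup_const]
  rw [mul_div_mul_right _ _ hk0]

/-! ### Achievability for all file sizes -/

/-- A zero-error scheme for file size `F₀` extends to larger files: the remaining bits of the
requested files are sent uncoded. -/
theorem CachingScheme.ZeroError.exists_extend {n m L : ℕ} {M : ℝ} (hM : 0 ≤ M) {F₀ F : ℕ}
    (hF : F₀ ≤ F) {S : CachingScheme n m L M F₀} (hS : S.ZeroError) {ℓ : Demand n m L → ℕ}
    (hℓ : ∀ W d, (S.encode W d).length = ℓ d) :
    ∃ S' : CachingScheme n m L M F, S'.ZeroError ∧
      ∀ W d, (S'.encode W d).length = ℓ d + n * L * (F - F₀) := by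
  have hfl : ⌊M * F₀⌋₊ ≤ ⌊M * F⌋₊ :=
    Nat.floor_le_floor (mul_le_mul_of_nonneg_left (Nat.cast_le.2 hF) hM)
  let res : Library m F → Library m F₀ := fun W f i => W f (Fin.castLE hF i)
  let ι := Fin n × Fin L × Fin (F - F₀)
  let rest : Library m F → Demand n m L → ι → ZMod 2 := fun W d x =>
    W (d x.1 x.2.1) ⟨F₀ + x.2.2, by omega⟩
  let cache : Fin n → Library m F → (Fin ⌊M * F⌋₊ → ZMod 2) := fun u W =>
    Function.extend (Fin.castLE hfl) (S.cache u (res W)) 0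
  let encode : Library m F → Demand n m L → List (ZMod 2) := fun W d =>
    S.encode (res W) d ++ List.ofFn fun i => rest W d ((Fintype.equivFin ι).symm i)
  obtain ⟨S', -, hSe, hS'⟩ := exists_zeroError cache encode (by
    intro W W' d u henc hcac l
    -- The concatenation can be split because the length of its first part depends on the requests
    -- only.
    obtain ⟨h1, h2⟩ := List.append_inj henc (by rw [hℓ, hℓ])
    have h3 : S.cache u (res W) = S.cache u (res W') := by
      funext i
      have := congrFun hcac (Fin.castLE hfl i)
      simpa only [cache, (Fin.castLE_injective hfl).extend_apply] using this
    have h4 := hS (res W) d u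
    rw [h1, h3, hS (res W') d u] at h4
    funext i
    rcases lt_or_ge i.val F₀ with hi | hi
    · exact (congrFun (congrFun h4 l) ⟨i, hi⟩).symm
    · have h5 := congrFun (List.ofFn_injective h2)
        (Fintype.equivFin ι (u, l, ⟨i - F₀, by omega⟩))
      simp only [Equiv.symm_apply_apply, rest, Nat.add_sub_cancel' hi] at h5
      exact h5)
  refine ⟨S', hS', fun W d => ?_⟩
  rw [hSe]
  simp [encode, hℓ, ι, mul_assoc]

/-- Uncoded transmission, obtained by extending the empty scheme. It supplies a scheme at every `F`,
including those too small for the good ones. -/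
theorem exists_zeroError_scheme (n m L : ℕ) {M : ℝ} (hM : 0 ≤ M) (F : ℕ) :
    ∃ S : CachingScheme n m L M F, S.ZeroError := by
  let S₀ : CachingScheme n m L M 0 := ⟨fun _ _ => 0, fun _ _ => [], fun _ _ _ _ => 0⟩
  have hS₀ : S₀.ZeroError := fun W d u => funext fun l => funext fun i => i.elim0
  obtain ⟨S, hS, -⟩ := hS₀.exists_extend hM (Nat.zero_le F) (ℓ := fun _ => 0) fun _ _ => rfl
  exact ⟨S, hS⟩

theorem CachingScheme.rate_zipf_zero_nonneg {n m L : ℕ} {M : ℝ} {F : ℕ}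
    (S : CachingScheme n m L M F) : 0 ≤ S.rate (zipf 0 m) :=
  Real.iSup_nonneg fun _ =>
    div_nonneg (demandExp_zipf_zero_nonneg fun _ => Nat.cast_nonneg _) (Nat.cast_nonneg _)

/-- Achievability from zero-error schemes of nearly the required rate. -/
theorem achievable_of_zeroError {n m L : ℕ} {M R : ℝ} (hM : 0 ≤ M)
    (h : ∀ ε : ℝ, 0 < ε → ∀ᶠ F : ℕ in atTop, ∃ S : CachingScheme n m L M F,
      S.ZeroError ∧ S.rate (zipf 0 m) ≤ R + ε) :
    Achievable n m L M (zipf 0 m) R := by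
  -- One sequence must serve every `ε`: at each `F`, a scheme within `1 / (F + 1)` of the infimum of
  -- the zero-error rates does.
  let rates (F : ℕ) : Set ℝ :=
    {r | ∃ S : CachingScheme n m L M F, S.ZeroError ∧ S.rate (zipf 0 m) = r}
  have hbdd : ∀ F, BddBelow (rates F) := fun F =>
    ⟨0, by rintro _ ⟨S, -, rfl⟩; exact S.rate_zipf_zero_nonneg⟩
  have hex : ∀ F : ℕ, ∃ S : CachingScheme n m L M F,
      S.ZeroError ∧ S.rate (zipf 0 m) < sInf (rates F) + 1 / ((F : ℝ) + 1) := by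
    intro F
    obtain ⟨S, hS⟩ := exists_zeroError_scheme n m L hM F
    obtain ⟨_, ⟨S', hS', rfl⟩, hlt⟩ := exists_lt_of_csInf_lt (s := rates F) ⟨_, S, hS, rfl⟩
      (lt_add_of_pos_right (sInf (rates F)) (Nat.one_div_pos_of_nat (n := F) (α := ℝ)))
    exact ⟨S', hS', hlt⟩
  choose S hS0 hSr using hex
  refine ⟨S, ?_, fun ε hε => ?_⟩
  · simp only [fun F => (hS0 F).errorProb_eq_zero (zipf 0 m)]
    exact tendsto_const_nhds
  · have hsmall : ∀ᶠ F : ℕ in atTop, 1 / ((F : ℝ) + 1) < ε / 2 :=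
      tendsto_one_div_add_atTop_nhds_zero_nat.eventually_lt_const (half_pos hε)
    filter_upwards [h (ε / 2) (half_pos hε), hsmall] with F ⟨S', hS', hr⟩ hF
    have h1 : sInf (rates F) ≤ S'.rate (zipf 0 m) := csInf_le (hbdd F) ⟨S', hS', rfl⟩
    linarith [hSr F]

theorem GreedyRule.achievable_rapGclcRate (g : GreedyRule) {n m L : ℕ} {M : ℝ} (hM : 0 < M)
    (hMm : M ≤ m) :
    Achievable n m L M (zipf 0 m) (g.rapGclcRate n m L M (zipf 0 m) (uniformPlacement m)) := by
  refine achievable_of_zeroError hM.le fun ε hε => ?_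
  have hm0 : (0 : ℝ) < m := hM.trans_le hMm
  have hm : 1 ≤ m := by exact_mod_cast hm0
  obtain ⟨B, hB, C, hC, hrate⟩ := g.exists_gclcRate_le n L hM hMm (half_pos hε)
  have hB0 : (0 : ℝ) < B := by exact_mod_cast hB
  have hdiv : Tendsto (fun F : ℕ => F / B) atTop atTop :=
    tendsto_atTop_atTop.2 fun b => ⟨b * B, fun F hF => (Nat.le_div_iff_mul_le hB).2 hF⟩
  have hsmall : ∀ᶠ F : ℕ in atTop, ((n * L * B : ℕ) : ℝ) / F < ε / 2 :=
    (tendsto_const_div_atTop_nhds_zero_nat _).eventually_lt_const (half_pos hε)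
  filter_upwards [hdiv.eventually (g.eventually_exists_isGCLC (L := L) hM hMm hC),
    hdiv.eventually (eventually_ge_atTop 1), hsmall, eventually_ge_atTop 1] with F hF hk hs hF1
  have hF0 : (0 : ℝ) < F := by exact_mod_cast hF1
  set k := F / B with hkdef
  let e : GaloisField 2 k ≃ₗ[ZMod 2] (Fin k → ZMod 2) :=
    LinearEquiv.ofFinrankEq _ _ (by
      rw [GaloisField.finrank 2 (by omega)]
      simp)
  obtain ⟨S, -, hS0, hlen⟩ := hF e
  have hBk : B * k ≤ F := Nat.mul_div_le F B
  obtain ⟨S', hS', hlen'⟩ := hS0.exists_extend hM.le hBk hlen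
  refine ⟨S', hS', ?_⟩
  simp only [CachingScheme.rate, hlen', ciSup_const]
  -- Fewer than `B` bits per file are left over, hence at most `n * L * B` uncoded bits, negligible
  -- against `F`.
  have hrest : F - B * k ≤ B := by
    have : F < B * (k + 1) := Nat.lt_mul_div_succ F hB
    rw [mul_add, mul_one] at this
    omega
  have h1 : demandExp (zipf 0 m) (fun d : Demand n m L =>
      ((g.transmissions C d * k + n * L * (F - B * k) : ℕ) : ℝ)) ≤
      g.gclcRate L (zipf 0 m) C * (B * k) + (n * L * B : ℕ) := by
    have e1 : g.gclcRate L (zipf 0 m) C * (B * k) =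
        demandExp (zipf 0 m) (fun d : Demand n m L => (g.transmissions C d : ℝ) * k) := by
      rw [demandExp_mul_const, GreedyRule.gclcRate]
      field_simp
    rw [e1, ← demandExp_zipf_zero_const (n := n) (L := L) hm ((n * L * B : ℕ) : ℝ),
      ← demandExp_add]
    refine demandExp_zipf_zero_mono fun d => ?_
    have : g.transmissions C d * k + n * L * (F - B * k) ≤
        g.transmissions C d * k + n * L * B := by gcongr
    exact_mod_cast this
  have h2 : g.gclcRate L (zipf 0 m) C * (B * k) ≤ g.gclcRate L (zipf 0 m) C * F :=
    mul_le_mul_of_nonneg_left (by exact_mod_cast hBk) (g.gclcRate_nonneg L C)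
  rw [div_le_iff₀ hF0]
  rw [div_lt_iff₀ hF0] at hs
  nlinarith

end CodedCaching

end

/-! ### The theorem -/

theorem theorem2 :
    -- UP-GCLC is a caching scheme, and its rate is bounded as stated
    (∀ (g : CodedCaching.GreedyRule) (n m L : ℕ) (M : ℝ), 1 ≤ n → 1 ≤ L → 0 < M → M ≤ m →
      (∀ B : ℕ, 1 ≤ B →
        ∀ C ∈ CodedCaching.rapPlacements n m B M (CodedCaching.uniformPlacement m),
        ∀ᶠ k : ℕ in atTop, ∀ e : GaloisField 2 k ≃ₗ[ZMod 2] (Fin k → ZMod 2),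
          ∃ S : CodedCaching.CachingScheme n m L M (B * k),
            S.IsGCLC g e C ∧
            S.errorProb (CodedCaching.zipf 0 m) = 0 ∧
            S.rate (CodedCaching.zipf 0 m) = g.gclcRate L (CodedCaching.zipf 0 m) C) ∧
      (∀ ε : ℝ, 0 < ε →
        Tendsto (fun B : ℕ =>
          CodedCaching.rapProb n m B M (CodedCaching.uniformPlacement m) (fun C =>
            g.gclcRate L (CodedCaching.zipf 0 m) C ≤
              min ((L : ℝ) * ((m : ℝ) / M - 1)) (min ((L : ℝ) * n) ((m : ℝ) - M)) + ε))
          atTop (𝓝 1)) ∧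
      g.rapGclcRate n m L M (CodedCaching.zipf 0 m) (CodedCaching.uniformPlacement m) ≤
        min ((L : ℝ) * ((m : ℝ) / M - 1)) (min ((L : ℝ) * n) ((m : ℝ) - M)) ∧
      CodedCaching.Achievable n m L M (CodedCaching.zipf 0 m)
        (g.rapGclcRate n m L M (CodedCaching.zipf 0 m) (CodedCaching.uniformPlacement m))) ∧
    -- the rate, and already its upper bound, is order-optimal
    ∃ ν : ℝ, 1 ≤ ν ∧
      ∀ (n L : ℕ → ℕ) (M : ℕ → ℝ), Tendsto n atTop atTop →
        (∀ᶠ m : ℕ in atTop, 1 ≤ L m ∧ 0 < M m ∧ M m ≤ m) →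
        (∀ g : CodedCaching.GreedyRule, CodedCaching.LimsupRatioLE
          (fun m => g.rapGclcRate (n m) m (L m) (M m) (CodedCaching.zipf 0 m)
            (CodedCaching.uniformPlacement m))
          (fun m => CodedCaching.optimalRate (n m) m (L m) (M m) (CodedCaching.zipf 0 m)) ν) ∧
        CodedCaching.LimsupRatioLE
          (fun m => min ((L m : ℝ) * ((m : ℝ) / M m - 1))
            (min ((L m : ℝ) * n m) ((m : ℝ) - M m)))
          (fun m => CodedCaching.optimalRate (n m) m (L m) (M m) (CodedCaching.zipf 0 m)) ν := by
  refine ⟨fun g n m L M _ _ hM hMm => ⟨fun B _ C hC => ?_,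
    fun ε hε => g.tendsto_rapProb_gclcRate_le n L hM hMm hε, g.rapGclcRate_le n L hM hMm,
    g.achievable_rapGclcRate hM hMm⟩, 32, by norm_num, fun n L M hn hLM => ?_⟩
  · filter_upwards [g.eventually_exists_isGCLC (L := L) hM hMm hC, eventually_ge_atTop 1]
      with k hk hk1 e
    obtain ⟨S, hS, hS0, hlen⟩ := hk e
    exact ⟨S, hS, hS0.errorProb_eq_zero _, CodedCaching.CachingScheme.rate_eq_gclcRate hk1 hlen⟩
  -- The rule `g` serves only to show that the set of achievable rates is nonempty, so that lower
  -- bounds pass to its infimum.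
  · have hopt : ∀ᶠ m : ℕ in atTop, ∀ g : CodedCaching.GreedyRule,
        0 ≤ CodedCaching.optimalRate (n m) m (L m) (M m) (CodedCaching.zipf 0 m) ∧
        min ((L m : ℝ) * ((m : ℝ) / M m - 1)) (min ((L m : ℝ) * n m) ((m : ℝ) - M m)) ≤
          32 * CodedCaching.optimalRate (n m) m (L m) (M m) (CodedCaching.zipf 0 m) := by
      filter_upwards [hLM, hn.eventually_ge_atTop 1] with m ⟨hL, hM, hMm⟩ hn1 g
      have hle : min ((L m : ℝ) * ((m : ℝ) / M m - 1)) (min ((L m : ℝ) * n m) ((m : ℝ) - M m)) ≤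
          32 * CodedCaching.optimalRate (n m) m (L m) (M m) (CodedCaching.zipf 0 m) := by
        rw [← div_le_iff₀' (by norm_num)]
        refine le_csInf ⟨_, g.achievable_rapGclcRate hM hMm⟩ fun R hR => ?_
        rw [div_le_iff₀' (by norm_num)]
        exact CodedCaching.Achievable.min_le hR hn1 hL hM hMm
      have h0 : 0 ≤ min ((L m : ℝ) * ((m : ℝ) / M m - 1))
          (min ((L m : ℝ) * n m) ((m : ℝ) - M m)) := by
        refine le_min (mul_nonneg (Nat.cast_nonneg _) ?_) (le_min (by positivity) (by linarith))
        rw [sub_nonneg, one_le_div hM]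
        exact hMm
      exact ⟨by linarith, hle⟩
    refine ⟨fun g ε hε => ?_, fun ε hε => ?_⟩
    · filter_upwards [hopt, hLM] with m hm ⟨_, hM, hMm⟩
      obtain ⟨h0, h1⟩ := hm g
      have := g.rapGclcRate_le (n m) (L m) hM hMm
      nlinarith
    · filter_upwards [hopt] with m hm
      obtain ⟨h0, h1⟩ := hm (Classical.arbitrary _)
      nlinarith
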